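/- Let $n\ge 1$, let $U$ be a random matrix distributed according to normalized Haar measure on the unitary group $\mathbb U(n)$, let $e_1=(1,0,\dots,0)^T$, and let $\mu$ be the spectral measure of $(U,e_1)$, i.e. the unique finite Borel measure on the unit circle $S^1\subset\mathbb C$ with $\langle e_1, U^k e_1\rangle=\int z^k\,d\mu(z)$ for all $k\in\mathbb Z$. Let $\Phi_0,\Phi_1,\dots,\Phi_n$ be the monic orthogonal polynomials obtained by applying the Gram–Schmidt procedure to $1,z,\dots,z^n$ in $L^2(\mu)$ (inner product $\langle f,g\rangle=\int\overline{f}\,g\,d\mu$), and for $\Phi_k(z)=\sum_{l=0}^k c_l z^l$ put $\Phi_k^*(z)=\sum_{l=0}^k\overline{c_{k-l}}\,z^l$. Then almost surely there are Verblunsky parameters $\alpha_0,\dots,\alpha_{n-1}$ of $\mu$, i.e. complex numbers with $$\Phi_{k+1}(z)=z\Phi_k(z)-\bar\alpha_k\Phi_k^*(z),\qquad 0\le k\le n-1,$$ and they are uniquely determined. Writing $\alpha_{n-1}=e^{i\phi}$ with $0\le\phi<2\pi$, the joint law of $(\alpha_0,\dots,\alpha_{n-2},\alpha_{n-1})$ is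 given by $$\frac12\,\frac{(n-1)!}{\pi^n}\prod_{k=0}^{n-2}\bigl(1-|\alpha_k|^2\bigr)^{n-2-k}\;d^2\alpha_0\cdots d^2\alpha_{n-2}\,d\phi,\qquad |\alpha_k|<1\ (0\le k\le n-2),\quad 0\le\phi<2\pi .$$ That is, $\alpha_0,\dots,\alpha_{n-1}$ are independent and $\alpha_k\sim\Theta_{2n-2k-1}$ for $0\le k\le n-1$. Here, for $\nu>1$, $\Theta_\nu$ is the probability law on the open unit disk with density $\frac{\nu-1}{2\pi}(1-|z|^2)^{(\nu-3)/2}$ with respect to Lebesgue measure $d^2z$, and $\Theta_1$ is the uniform distribution on the unit circle. -/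

import Mathlib

open MeasureTheory ProbabilityTheory Polynomial
open scoped Matrix

/-- The unit circle carries its Borel σ-algebra. -/
noncomputable instance circleMeasurableSpace : MeasurableSpace Circle := borel Circle

instance circleBorelSpace : BorelSpace Circle := ⟨rfl⟩

/-- `μ` is a spectral measure of the unitary matrix `U` and the vector `v`:
a finite Borel measure on the unit circle with `⟨v | U ^ k v⟩ = ∫ z ^ k dμ(z)` for all `k ∈ ℤ`. -/
structure IsSpectralMeasure {n : ℕ} (U : Matrix.unitaryGroup (Fin n) ℂ) (v : Fin n → ℂ)
    (μ : Measure Circle) : Prop where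
  isFiniteMeasure : IsFiniteMeasure μ
  moment : ∀ k : ℤ,
    ∫ z : Circle, (z : ℂ) ^ k ∂μ = star v ⬝ᵥ ((U ^ k : Matrix.unitaryGroup (Fin n) ℂ).1 *ᵥ v)

/-- A finite measure on the unit circle is determined by its moments. -/
theorem circle_measure_ext {μ ν : Measure Circle} [IsFiniteMeasure μ] [IsFiniteMeasure ν]
    (h : ∀ k : ℤ, ∫ z : Circle, (z : ℂ) ^ k ∂μ = ∫ z : Circle, (z : ℂ) ^ k ∂ν) : μ = ν := by
  let m : ℤ → Circle → ℂ := fun k z => (z : ℂ) ^ k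
  have hmc : ∀ k, Continuous (m k) := fun k => by
    have : m k = fun z : Circle => ((z ^ k : Circle) : ℂ) := by
      funext z; simp [m]
    rw [this]
    exact continuous_subtype_val.comp (continuous_zpow k)
  have hmul : ∀ a b, a ∈ Submodule.span ℂ (Set.range m) → b ∈ Submodule.span ℂ (Set.range m) →
      a * b ∈ Submodule.span ℂ (Set.range m) := by
    intro a b ha hb
    have := Submodule.mul_mem_mul ha hb
    rw [Submodule.span_mul_span] at this
    refine Submodule.span_mono ?_ this
    rintro _ ⟨_, ⟨k, rfl⟩, _, ⟨l, rfl⟩, rfl⟩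
    exact ⟨k + l, by funext z; simp [m, zpow_add₀]⟩
  have hstar : ∀ a, a ∈ Submodule.span ℂ (Set.range m) →
      star a ∈ Submodule.span ℂ (Set.range m) := by
    intro a ha
    induction ha using Submodule.span_induction with
    | mem x hx =>
      obtain ⟨k, rfl⟩ := hx
      refine Submodule.subset_span ⟨-k, ?_⟩
      funext z
      simp [m, ← Circle.coe_inv_eq_conj]
    | zero => simp
    | add x y _ _ hx hy => rw [star_add]; exact add_mem hx hy
    | smul c x _ hx => rw [star_smul]; exact Submodule.smul_mem _ _ hx
  have hone : (1 : Circle → ℂ) ∈ Submodule.span ℂ (Set.range m) :=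
    Submodule.subset_span ⟨0, by funext z; simp [m]⟩
  let A : StarSubalgebra ℂ (BoundedContinuousFunction Circle ℂ) :=
    { carrier := {f | (f : Circle → ℂ) ∈ Submodule.span ℂ (Set.range m)}
      mul_mem' := fun {a b} ha hb => by
        have := hmul _ _ ha hb
        simpa using this
      add_mem' := fun {a b} ha hb => by
        have := Submodule.add_mem (Submodule.span ℂ (Set.range m)) (Set.mem_ofPred_eq ▸ ha)
          (Set.mem_ofPred_eq ▸ hb)
        simpa using this
      algebraMap_mem' := fun r => by
        have := Submodule.smul_mem _ r hone
        have h2 : ((algebraMap ℂ (BoundedContinuousFunction Circle ℂ) r :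
            BoundedContinuousFunction Circle ℂ) : Circle → ℂ) = r • (1 : Circle → ℂ) := by
          funext z
          simp
        rw [Set.mem_ofPred_eq, h2]
        exact this
      star_mem' := fun {a} ha => by
        have := hstar _ ha
        simpa using this }
  refine ext_of_forall_mem_subalgebra_integral_eq_of_pseudoEMetric_complete_countable
    (𝕜 := ℂ) (A := A) ?_ ?_
  · intro x y hxy
    let g : BoundedContinuousFunction Circle ℂ :=
      BoundedContinuousFunction.mkOfCompact ⟨m 1, hmc 1⟩
    refine ⟨m 1, ⟨⟨m 1, hmc 1⟩, ⟨g, Submodule.subset_span ⟨1, rfl⟩, rfl⟩, rfl⟩, ?_⟩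
    simpa [m, Circle.ext_iff] using hxy
  · intro g hg
    have key : ∀ f ∈ Submodule.span ℂ (Set.range m),
        Continuous f ∧ ∫ x, f x ∂μ = ∫ x, f x ∂ν := by
      intro f hf
      have hint : ∀ {f : Circle → ℂ}, Continuous f → ∀ (ρ : Measure Circle) [IsFiniteMeasure ρ],
          Integrable f ρ := fun {f} hf ρ _ =>
        (BoundedContinuousFunction.mkOfCompact ⟨f, hf⟩).integrable ρ
      induction hf using Submodule.span_induction with
      | mem x hx => obtain ⟨k, rfl⟩ := hx; exact ⟨hmc k, h k⟩
      | zero => exact ⟨continuous_zero, by simp⟩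
      | add x y _ _ hx hy =>
        refine ⟨hx.1.add hy.1, ?_⟩
        simp only [Pi.add_apply]
        rw [integral_add (hint hx.1 μ) (hint hy.1 μ), integral_add (hint hx.1 ν) (hint hy.1 ν),
          hx.2, hy.2]
      | smul c x _ hx =>
        refine ⟨hx.1.const_smul c, ?_⟩
        simp only [Pi.smul_apply]
        rw [integral_smul, integral_smul, hx.2]
    exact (key _ hg).2

section
open scoped Matrix.Norms.L2Operator

theorem exists_isSpectralMeasure {n : ℕ} (U : Matrix.unitaryGroup (Fin n) ℂ) (v : Fin n → ℂ) :
    ∃ μ : Measure Circle, IsSpectralMeasure U v μ := by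
  classical
  have hfin : (spectrum ℂ U.1).Finite := Matrix.finite_spectrum U.1
  have hcont : ∀ f : ℂ → ℂ, ContinuousOn f (spectrum ℂ U.1) := fun f => hfin.continuousOn f
  have hnormal : IsStarNormal U.1 := inferInstance
  have hsph := Unitary.spectrum_subset_circle (𝕜 := ℂ) U
  let S : Finset ℂ := hfin.toFinset
  let e : ℂ → ℂ → ℂ := fun l z => if z = l then 1 else 0
  let P : ℂ → Matrix (Fin n) (Fin n) ℂ := fun l => cfc (e l) U.1
  let c : ℂ → Circle := fun l => if h : ‖l‖ = 1 then ⟨l, mem_sphere_zero_iff_norm.2 h⟩ else 1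
  let w : ℂ → ℝ := fun l => ‖WithLp.toLp 2 (P l *ᵥ v)‖ ^ 2
  have hw : ∀ l, star v ⬝ᵥ (P l *ᵥ v) = (w l : ℂ) := by
    intro l
    have h1 : P l = star (P l) * P l := by
      simp only [P]
      rw [← cfc_star, ← cfc_mul _ _ _ (hcont _) (hcont _)]
      congr 1
      funext z
      by_cases hz : z = l <;> simp [e, hz]
    have h2 : ((w l : ℝ) : ℂ) = inner ℂ (WithLp.toLp 2 (P l *ᵥ v)) (WithLp.toLp 2 (P l *ᵥ v)) := by
      rw [inner_self_eq_norm_sq_to_K]; simp [w]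
    rw [h2, EuclideanSpace.inner_toLp_toLp]
    conv_lhs => rw [h1]
    rw [← Matrix.mulVec_mulVec, Matrix.dotProduct_mulVec, Matrix.star_eq_conjTranspose,
      ← Matrix.star_mulVec, dotProduct_comm]
  have hz : ∀ k : ℤ, (U ^ k : Matrix.unitaryGroup (Fin n) ℂ).1 = ∑ l ∈ S, l ^ k • P l := by
    intro k
    have h1 : cfc (fun x : ℂ => x ^ k) U.1 = (U ^ k : Matrix.unitaryGroup (Fin n) ℂ).1 := by
      have := cfc_zpow (R := ℂ) (p := IsStarNormal) (Unitary.toUnits U) k (by simpa using hnormal)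
      rw [← map_zpow] at this
      exact this
    have h2 : (spectrum ℂ U.1).EqOn (fun x : ℂ => x ^ k)
        (∑ l ∈ S, fun x => l ^ k * e l x) := by
      intro x hx
      have hxS : x ∈ S := by simpa [S] using hx
      simp [Finset.sum_apply, e, hxS]
    rw [← h1, cfc_congr h2, cfc_sum _ _ _ (fun _ _ => hcont _)]
    refine Finset.sum_congr rfl fun l _ => ?_
    rw [cfc_const_mul _ _ _ (hcont _)]
  refine ⟨∑ l ∈ S, (ENNReal.ofReal (w l)) • Measure.dirac (c l), ⟨⟨?_⟩, ?_⟩⟩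
  · simp [Measure.finsetSum_apply]
  intro k
  rw [hz k, integral_finsetSum_measure]
  · rw [Matrix.sum_mulVec, dotProduct_sum]
    refine Finset.sum_congr rfl fun l hl => ?_
    have hl1 : ‖l‖ = 1 := by
      have : l ∈ spectrum ℂ U.1 := by simpa [S] using hl
      simpa using hsph this
    rw [integral_smul_measure, integral_dirac, Matrix.smul_mulVec, dotProduct_smul, hw,
      ENNReal.toReal_ofReal (by positivity)]
    simp [c, hl1, mul_comm]
  · intro l _
    refine Integrable.smul_measure ?_ (by simp)
    exact integrable_dirac (by simp)

end

theorem existsUnique_isSpectralMeasure {n : ℕ} (U : Matrix.unitaryGroup (Fin n) ℂ)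
    (v : Fin n → ℂ) : ∃! μ : Measure Circle, IsSpectralMeasure U v μ := by
  obtain ⟨μ, hμ⟩ := exists_isSpectralMeasure U v
  refine ⟨μ, hμ, fun ν hν => ?_⟩
  have := hμ.isFiniteMeasure
  have := hν.isFiniteMeasure
  exact circle_measure_ext fun k => (hν.moment k).trans (hμ.moment k).symm

/-- The spectral measure of the pair `(U, v)`. -/
noncomputable def spectralMeasure {n : ℕ} (U : Matrix.unitaryGroup (Fin n) ℂ) (v : Fin n → ℂ) :
    Measure Circle :=
  (existsUnique_isSpectralMeasure U v).choose

theorem isSpectralMeasure_spectralMeasure {n : ℕ} (U : Matrix.unitaryGroup (Fin n) ℂ)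
    (v : Fin n → ℂ) : IsSpectralMeasure U v (spectralMeasure U v) :=
  (existsUnique_isSpectralMeasure U v).choose_spec.1

/-- The inner product `⟨f | g⟩ = ∫ conj (f z) * g z dμ(z)` of two polynomials in `L²(μ)`. -/
noncomputable def polyInner (μ : Measure Circle) (f g : ℂ[X]) : ℂ :=
  ∫ z : Circle, starRingEnd ℂ (f.eval (z : ℂ)) * g.eval (z : ℂ) ∂μ

/-- The monic orthogonal polynomials `Φ_0, Φ_1, …` of `μ`: the Gram–Schmidt procedure applied to
`1, z, z ^ 2, …` in `L²(μ)`. If the support of `μ` consists of `n` points, then `Φ_j` is the unique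
monic polynomial of degree `j` orthogonal to all polynomials of lower degree, for every `j ≤ n`
(and `Φ_n` is the polynomial with simple zeros at the `n` points). -/
noncomputable def monicOP (μ : Measure Circle) (k : ℕ) : ℂ[X] :=
  X ^ k - ∑ j : Fin k,
    C (polyInner μ (monicOP μ j) (X ^ k) / polyInner μ (monicOP μ j) (monicOP μ j)) * monicOP μ j
termination_by k
decreasing_by exact j.2

/-- The reversed polynomial of degree `k`: if `f = ∑_{l ≤ k} c_l z ^ l`
then `f^* = ∑_{l ≤ k} conj (c_{k - l}) z ^ l`. -/
noncomputable def reversedPoly (k : ℕ) (f : ℂ[X]) : ℂ[X] :=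
  ∑ l ∈ Finset.range (k + 1), C (starRingEnd ℂ (f.coeff (k - l))) * X ^ l

/-- `a` is a coefficient of the Szegő recurrence `Φ_{k+1} = z Φ_k - conj a Φ_k^*`. -/
def IsRecurrenceCoeff (μ : Measure Circle) (k : ℕ) (a : ℂ) : Prop :=
  monicOP μ (k + 1) =
    X * monicOP μ k - C (starRingEnd ℂ a) * reversedPoly k (monicOP μ k)

open Classical in
/-- The `k`-th Verblunsky parameter `α_k` of `μ`: the recurrence coefficient. It exists when the
support of `μ` has more than `k` points; where the recurrence has no coefficient, the value is `0`
by convention. -/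
noncomputable def verblunsky (μ : Measure Circle) (k : ℕ) : ℂ :=
  if h : ∃ a, IsRecurrenceCoeff μ k a then h.choose else 0

/-- The law `Θ_ν`: for `ν > 1` it has density `(ν - 1) / (2 π) * (1 - |z|²) ^ ((ν - 3) / 2)` with
respect to Lebesgue measure on the open unit disk of `ℂ`; for `ν = 1` it is the uniform
distribution on the unit circle of `ℂ`. -/
noncomputable def thetaMeasure (ν : ℝ) : Measure ℂ :=
  if ν = 1 then
    ((volume.restrict (Set.Ico 0 (2 * Real.pi))).withDensity
      (fun _ => ENNReal.ofReal (1 / (2 * Real.pi)))).map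
      (fun φ : ℝ => Complex.exp (φ * Complex.I))
  else
    (volume.restrict (Metric.ball (0 : ℂ) 1)).withDensity
      (fun z => ENNReal.ofReal ((ν - 1) / (2 * Real.pi) * (1 - ‖z‖ ^ 2) ^ ((ν - 3) / 2)))

/-- The measure `½ (n-1)! / π ^ n ∏_{k=0}^{n-2} (1 - |α_k|²) ^ (n-2-k) d²α_0 ⋯ d²α_{n-2} dφ`
in the coordinates `((α_0, …, α_{n-2}), φ)`, where `|α_k| < 1` and `0 ≤ φ < 2 π`. -/
noncomputable def verblunskyDensityMeasure (n : ℕ) : Measure ((Fin (n - 1) → ℂ) × ℝ) :=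
  ((volume.restrict {a : Fin (n - 1) → ℂ | ∀ k, ‖a k‖ < 1}).prod
    (volume.restrict (Set.Ico 0 (2 * Real.pi)))).withDensity
    (fun p => ENNReal.ofReal
      (1 / 2 * ((n - 1).factorial / Real.pi ^ n) *
        ∏ k : Fin (n - 1), (1 - ‖p.1 k‖ ^ 2) ^ (n - 2 - (k : ℕ))))

/-! ### The Szegő recursion -/

/-! The proof is an induction on the size of the matrix that peels off `α_0`. Write `e` for the
first basis vector, `c = U_00`, `a = conj c`, and let `Θ(a)` be the block `[[conj a, ρ], [ρ, -a]] ⊕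
1` with `ρ² = 1 - |a|²`. If `|c| < 1`, the first column of `U` gives a factorisation `U = (1 ⊕ W)
Θ(a) (1 ⊕ V₀)` (`exists_decomposition`). Conjugation by `1 ⊕ W` fixes `e`, so it does not change the
spectral measure; hence `U (1 ⊕ V)` has the spectral measure of `Θ(a) (1 ⊕ V₀ V W)`.

The algebraic core is `IsSzego.cons`: the recurrence coefficients of `Θ(a) (1 ⊕ V')` are `a`
followed by those of `V'`. Indeed, if `Φ` and `Ψ` denote the orthogonal polynomials of the large and
the small matrix, then `Φ_{k+1}(M) e = ρ (0, Ψ_k(V') e)`.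

The probabilistic core is invariance. Let `V` be Haar distributed on the smaller group and
independent of `U`. Then `U (1 ⊕ V)` has the law of `U`, and its first coefficient is still `conj
U_00`. With `U` fixed, `V₀ V W` is again Haar, so the remaining coefficients have the law given by
the induction hypothesis, whatever `U` is. This yields independence and reduces the theorem to the
law of `conj U_00` (`law_recCoeff`).

That entry is distributed as one coordinate of a uniform unit vector. Its law is computed from
Lebesgue measure on the Euclidean ball by the projective coordinate `t = x_0 / |b|`, where `b` is
the vector of the other coordinates (`lintegral_sqBall_eq_mul`); for size one it is uniform on the
circle.

Polynomials enter through the vectors `p(U) e`, as `p ↦ p(U) e` carries the inner product of `L²(μ)`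
to that of `ℂ^n`. The choice in `verblunsky` is avoided by `recCoeff`, which is defined everywhere,
measurable, and the only possible recurrence coefficient. -/

theorem coeff_reversedPoly (k l : ℕ) (f : ℂ[X]) :
    (reversedPoly k f).coeff l = if l ≤ k then starRingEnd ℂ (f.coeff (k - l)) else 0 := by
  simp only [reversedPoly, finsetSum_coeff, coeff_C_mul, coeff_X_pow, mul_ite, mul_one, mul_zero]
  rw [Finset.sum_ite_eq]
  simp

theorem reversedPoly_sub (k : ℕ) (f g : ℂ[X]) :
    reversedPoly k (f - g) = reversedPoly k f - reversedPoly k g := by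
  ext l
  simp only [coeff_sub, coeff_reversedPoly, map_sub]
  split_ifs <;> simp

theorem reversedPoly_C_mul (k : ℕ) (c : ℂ) (f : ℂ[X]) :
    reversedPoly k (C c * f) = C (starRingEnd ℂ c) * reversedPoly k f := by
  ext l
  simp only [coeff_C_mul, coeff_reversedPoly, map_mul]
  split_ifs <;> simp

theorem reversedPoly_succ_X_mul (k : ℕ) (f : ℂ[X]) :
    reversedPoly (k + 1) (X * f) = reversedPoly k f := by
  ext l
  simp only [coeff_reversedPoly]
  rcases lt_trichotomy l (k + 1) with h | h | h
  · rw [if_pos (by omega), if_pos (by omega), show k + 1 - l = (k - l) + 1 by omega, coeff_X_mul]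
  · subst h; simp
  · rw [if_neg (by omega), if_neg (by omega)]

theorem reversedPoly_succ_reversedPoly {k : ℕ} {f : ℂ[X]} (hf : f.natDegree ≤ k) :
    reversedPoly (k + 1) (reversedPoly k f) = X * f := by
  ext l
  simp only [coeff_reversedPoly]
  rcases l with _ | l
  · simp
  · rw [coeff_X_mul]
    by_cases h : l ≤ k
    · rw [if_pos (by omega), if_pos (by omega), show k - (k + 1 - (l + 1)) = l by omega]
      simp
    · rw [if_neg (by omega), coeff_eq_zero_of_natDegree_lt (by omega)]

/-- The pair `(Φ_k, Φ_k^*)` generated by the Szegő recursion with coefficients `a`. -/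
noncomputable def szego (a : ℕ → ℂ) : ℕ → ℂ[X] × ℂ[X]
  | 0 => (1, 1)
  | k + 1 => (X * (szego a k).1 - C (starRingEnd ℂ (a k)) * (szego a k).2,
      (szego a k).2 - C (a k) * (X * (szego a k).1))

/-- Reversal in degree `k + 1` exchanges `X * Φ_k` and `Φ_k^*`, so reversing the first recursion
gives the second one. -/
theorem szego_spec (a : ℕ → ℂ) (k : ℕ) :
    (szego a k).1.Monic ∧ (szego a k).1.natDegree = k ∧
      (szego a k).2 = reversedPoly k (szego a k).1 := by
  induction k with
  | zero =>
    refine ⟨monic_one, natDegree_one, ?_⟩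
    ext l
    rw [coeff_reversedPoly]
    rcases l with _ | l <;> simp [szego, coeff_one]
  | succ k ih =>
    obtain ⟨h1, h2, h3⟩ := ih
    have hm : (X * (szego a k).1).Monic := monic_X.mul h1
    have hd : (X * (szego a k).1).natDegree = k + 1 := by
      rw [monic_X.natDegree_mul h1, natDegree_X, h2, add_comm]
    have hr : (C (starRingEnd ℂ (a k)) * (szego a k).2).degree < ((k + 1 : ℕ) : WithBot ℕ) := by
      rw [degree_lt_iff_coeff_zero]
      intro l hl
      rw [coeff_C_mul, h3, coeff_reversedPoly, if_neg (by omega), mul_zero]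
    have hr' : (C (starRingEnd ℂ (a k)) * (szego a k).2).degree < (X * (szego a k).1).degree := by
      rw [degree_eq_natDegree hm.ne_zero, hd]; exact hr
    refine ⟨hm.sub_of_left hr', ?_, ?_⟩
    · rw [szego, natDegree_sub_eq_left_of_natDegree_lt]
      · exact hd
      · by_cases h0 : C (starRingEnd ℂ (a k)) * (szego a k).2 = 0
        · rw [h0, hd]; simp
        · exact natDegree_lt_natDegree h0 hr'
    · rw [szego, reversedPoly_sub, reversedPoly_C_mul, reversedPoly_succ_X_mul, h3,
        reversedPoly_succ_reversedPoly h2.le]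
      simp

/-- The vectors `Φ_k(M) e` and `Φ_k^*(M) e`, where `e` is the first basis vector. -/
noncomputable def szegoVec {m : ℕ} (M : Matrix (Fin (m + 1)) (Fin (m + 1)) ℂ) (p : ℂ[X]) :
    Fin (m + 1) → ℂ :=
  aeval M p *ᵥ Pi.single 0 1

section szegoVec

variable {m : ℕ} (M : Matrix (Fin (m + 1)) (Fin (m + 1)) ℂ)

theorem szegoVec_one : szegoVec M 1 = Pi.single 0 1 := by
  rw [szegoVec, map_one, Matrix.one_mulVec]

theorem szegoVec_sub (p q : ℂ[X]) : szegoVec M (p - q) = szegoVec M p - szegoVec M q := by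
  simp only [szegoVec, map_sub, Matrix.sub_mulVec]

theorem szegoVec_C_mul (c : ℂ) (p : ℂ[X]) : szegoVec M (C c * p) = c • szegoVec M p := by
  rw [szegoVec, ← smul_eq_C_mul, map_smul, Matrix.smul_mulVec, szegoVec]

theorem szegoVec_X_mul (p : ℂ[X]) : szegoVec M (X * p) = M *ᵥ szegoVec M p := by
  rw [szegoVec, map_mul, aeval_X, ← Matrix.mulVec_mulVec, szegoVec]

end szegoVec

/-- The Szegő recursion with coefficients `a` produces the orthogonal polynomials of `M` with
respect to the first basis vector. -/
structure IsSzego {m : ℕ} (M : Matrix (Fin (m + 1)) (Fin (m + 1)) ℂ) (a : ℕ → ℂ) : Prop where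
  orthogonal : ∀ j k, j < k → k ≤ m + 1 →
    star (szegoVec M (szego a j).1) ⬝ᵥ szegoVec M (szego a k).1 = 0
  ne_zero : ∀ k ≤ m, szegoVec M (szego a k).1 ≠ 0

/-! ### Block matrices -/

/-- The block matrix `1 ⊕ V`. -/
def oneSum {m : ℕ} (V : Matrix (Fin m) (Fin m) ℂ) : Matrix (Fin (m + 1)) (Fin (m + 1)) ℂ :=
  Matrix.of (Fin.cons (Fin.cons 1 0) fun i => Fin.cons 0 (V i))

theorem oneSum_mulVec_cons {m : ℕ} (V : Matrix (Fin m) (Fin m) ℂ) (c : ℂ) (x : Fin m → ℂ) :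
    oneSum V *ᵥ (Fin.cons c x : Fin (m + 1) → ℂ) = (Fin.cons c (V *ᵥ x) : Fin (m + 1) → ℂ) := by
  funext i
  refine Fin.cases ?_ (fun i => ?_) i <;>
    simp [oneSum, Matrix.mulVec, dotProduct, Fin.sum_univ_succ]

theorem oneSum_one {m : ℕ} : oneSum (1 : Matrix (Fin m) (Fin m) ℂ) = 1 := by
  ext i j
  refine Fin.cases ?_ (fun i => ?_) i <;> refine Fin.cases ?_ (fun j => ?_) j <;>
    simp [oneSum, Matrix.one_apply, Fin.succ_ne_zero, (Fin.succ_ne_zero _).symm]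

theorem oneSum_mul {m : ℕ} (V W : Matrix (Fin m) (Fin m) ℂ) :
    oneSum (V * W) = oneSum V * oneSum W := by
  ext i j
  refine Fin.cases ?_ (fun i => ?_) i <;> refine Fin.cases ?_ (fun j => ?_) j <;>
    simp [oneSum, Matrix.mul_apply, Fin.sum_univ_succ]

theorem oneSum_star {m : ℕ} (V : Matrix (Fin m) (Fin m) ℂ) :
    oneSum (star V) = star (oneSum V) := by
  ext i j
  refine Fin.cases ?_ (fun i => ?_) i <;> refine Fin.cases ?_ (fun j => ?_) j <;>
    simp [oneSum, Matrix.star_apply]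

theorem continuous_oneSum {m : ℕ} :
    Continuous (oneSum : Matrix (Fin m) (Fin m) ℂ → Matrix (Fin (m + 1)) (Fin (m + 1)) ℂ) := by
  refine continuous_matrix fun i j => ?_
  refine Fin.cases ?_ (fun i => ?_) i <;> refine Fin.cases ?_ (fun j => ?_) j <;>
    simp only [oneSum, Matrix.of_apply, Fin.cons_zero, Fin.cons_succ] <;> fun_prop

/-- The embedding `V ↦ 1 ⊕ V` of unitary groups. -/
def unitarySum {m : ℕ} : Matrix.unitaryGroup (Fin m) ℂ →* Matrix.unitaryGroup (Fin (m + 1)) ℂ where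
  toFun V := ⟨oneSum V.1, by
    rw [Matrix.mem_unitaryGroup_iff, ← oneSum_star, ← oneSum_mul,
      Matrix.mem_unitaryGroup_iff.1 V.2, oneSum_one]⟩
  map_one' := Subtype.ext oneSum_one
  map_mul' V W := Subtype.ext (oneSum_mul V.1 W.1)

theorem continuous_unitarySum {m : ℕ} :
    Continuous (unitarySum : Matrix.unitaryGroup (Fin m) ℂ → _) :=
  (continuous_oneSum.comp continuous_subtype_val).subtype_mk _

/-- The block `[[conj a, ρ], [ρ, -a]] ⊕ 1`. -/
def thetaBlock {m : ℕ} (a ρ : ℂ) : Matrix (Fin (m + 2)) (Fin (m + 2)) ℂ :=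
  Matrix.of (Fin.cons (Fin.cons (starRingEnd ℂ a) (Fin.cons ρ 0))
    (Fin.cons (Fin.cons ρ (Fin.cons (-a) 0))
      fun i => Fin.cons 0 (Fin.cons 0 ((1 : Matrix (Fin m) (Fin m) ℂ) i))))

theorem thetaBlock_mulVec {m : ℕ} (a ρ b c : ℂ) (x : Fin m → ℂ) :
    thetaBlock a ρ *ᵥ (Fin.cons b (Fin.cons c x : Fin (m + 1) → ℂ) : Fin (m + 2) → ℂ) =
      (Fin.cons (starRingEnd ℂ a * b + ρ * c) (Fin.cons (ρ * b - a * c) x : Fin (m + 1) → ℂ) :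
        Fin (m + 2) → ℂ) := by
  funext i
  refine Fin.cases ?_ (fun i => Fin.cases ?_ (fun i => ?_) i) i <;>
    simp [thetaBlock, Matrix.mulVec, dotProduct, Fin.sum_univ_succ, Matrix.one_apply] <;> ring

theorem thetaBlock_mul_star {m : ℕ} {a ρ : ℂ} (hρ : starRingEnd ℂ ρ = ρ)
    (h : a * starRingEnd ℂ a + ρ * ρ = 1) :
    (thetaBlock a ρ : Matrix (Fin (m + 2)) (Fin (m + 2)) ℂ) * star (thetaBlock a ρ) = 1 := by
  have hs : star (thetaBlock a ρ : Matrix (Fin (m + 2)) (Fin (m + 2)) ℂ) =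
      thetaBlock (starRingEnd ℂ a) ρ := by
    ext i j
    refine Fin.cases ?_ (fun i => Fin.cases ?_ (fun i => ?_) i) i <;>
      refine Fin.cases ?_ (fun j => Fin.cases ?_ (fun j => ?_) j) j <;>
      simp [thetaBlock, Matrix.star_apply, Matrix.one_apply, hρ, apply_ite (starRingEnd ℂ), eq_comm]
  refine Matrix.ext_of_mulVec_single fun i => ?_
  generalize (Pi.single i 1 : Fin (m + 2) → ℂ) = y
  obtain ⟨b, c, x, rfl⟩ : ∃ (b c : ℂ) (x : Fin m → ℂ),
      y = (Fin.cons b (Fin.cons c x : Fin (m + 1) → ℂ) : Fin (m + 2) → ℂ) :=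
    ⟨_, _, _, by rw [Fin.cons_self_tail, Fin.cons_self_tail]⟩
  rw [hs, ← Matrix.mulVec_mulVec, thetaBlock_mulVec, thetaBlock_mulVec, Matrix.one_mulVec]
  congr 2
  · simp only [Complex.conj_conj]
    linear_combination b * h
  · simp only [Complex.conj_conj]
    linear_combination c * h

/-! ### Adding a coefficient in front -/

/-- The factor `1 ⊕ V` turns `(0, Ψ_k)` into `(0, V Ψ_k)`, so one step of the recursion for `V`
takes place behind a common factor `ρ Θ(a)`. For `Φ` this factor `Θ(a)` then disappears, because
`Ψ_{k+1}(V) e ⟂ e`; for `Φ^*` it stays, which is why the two formulas differ and must be proved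
together. -/
theorem cons_zero_szegoVec {m : ℕ} {V : Matrix (Fin (m + 1)) (Fin (m + 1)) ℂ} {a ρ : ℂ}
    (h : a * starRingEnd ℂ a + ρ * ρ = 1) {b : ℕ → ℂ} (hV : IsSzego V b) (k : ℕ) (hk : k ≤ m + 1) :
    szegoVec (thetaBlock a ρ * oneSum V)
        (szego (fun i => Nat.casesOn i a b : ℕ → ℂ) (k + 1)).1 =
      ρ • (Fin.cons 0 (szegoVec V (szego b k).1) : Fin (m + 2) → ℂ) ∧
    szegoVec (thetaBlock a ρ * oneSum V)
        (szego (fun i => Nat.casesOn i a b : ℕ → ℂ) (k + 1)).2 =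
      ρ • (thetaBlock a ρ *ᵥ (Fin.cons 0 (szegoVec V (szego b k).2) : Fin (m + 2) → ℂ)) := by
  have hsingle : ∀ n, (Pi.single 0 1 : Fin (n + 1) → ℂ) = Fin.cons 1 0 := by
    intro n; funext i; refine Fin.cases ?_ (fun i => ?_) i <;> simp
  have hz : ∀ n, (0 : Fin (n + 1) → ℂ) = Fin.cons 0 0 := by
    intro n; funext i; refine Fin.cases ?_ (fun i => ?_) i <;> simp
  have hsmul : ∀ n (c d : ℂ) (x : Fin n → ℂ),
      c • (Fin.cons d x : Fin (n + 1) → ℂ) = Fin.cons (c * d) (c • x) := by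
    intro n c d x; funext i; refine Fin.cases ?_ (fun i => ?_) i <;> simp
  have hsub : ∀ n (c d : ℂ) (x y : Fin n → ℂ),
      (Fin.cons c x - Fin.cons d y : Fin (n + 1) → ℂ) = Fin.cons (c - d) (x - y) := by
    intro n c d x y; funext i; refine Fin.cases ?_ (fun i => ?_) i <;> simp
  induction k with
  | zero =>
    simp only [szego, szegoVec_sub, szegoVec_C_mul, szegoVec_X_mul, szegoVec_one]
    rw [← Matrix.mulVec_mulVec, hsingle, hsingle, oneSum_mulVec_cons, Matrix.mulVec_zero]
    rw [hz, thetaBlock_mulVec, thetaBlock_mulVec]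
    simp only [hsmul, hsub, smul_zero, sub_self, mul_zero, mul_one, add_zero, zero_add, sub_zero]
    refine ⟨by simp, ?_⟩
    congr 1
    · linear_combination -h
    · congr 1
      ring
  | succ k ih =>
    obtain ⟨h1, h2⟩ := ih (by omega)
    set α : ℕ → ℂ := fun i => Nat.casesOn i a b with hα
    have hα1 : α (k + 1) = b k := rfl
    have e1 : szegoVec (thetaBlock a ρ * oneSum V) (szego α (k + 1 + 1)).1 =
        ρ • (thetaBlock a ρ *ᵥ (Fin.cons 0 (szegoVec V (szego b (k + 1)).1) : Fin (m + 2) → ℂ)) := by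
      rw [szego, szegoVec_sub, szegoVec_C_mul, szegoVec_X_mul, h1, h2, ← Matrix.mulVec_mulVec,
        Matrix.mulVec_smul, oneSum_mulVec_cons, Matrix.mulVec_smul, smul_comm, ← smul_sub,
        ← Matrix.mulVec_smul, ← Matrix.mulVec_sub, hsmul, hsub, szego, szegoVec_sub,
        szegoVec_C_mul, szegoVec_X_mul, hα1]
      simp
    have e2 : szegoVec (thetaBlock a ρ * oneSum V) (szego α (k + 1 + 1)).2 =
        ρ • (thetaBlock a ρ *ᵥ (Fin.cons 0 (szegoVec V (szego b (k + 1)).2) : Fin (m + 2) → ℂ)) := by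
      rw [szego, szegoVec_sub, szegoVec_C_mul, szegoVec_X_mul, h1, h2, ← Matrix.mulVec_mulVec,
        Matrix.mulVec_smul, oneSum_mulVec_cons, Matrix.mulVec_smul, smul_comm, ← smul_sub,
        ← Matrix.mulVec_smul, ← Matrix.mulVec_sub, hsmul, hsub, szego, szegoVec_sub,
        szegoVec_C_mul, szegoVec_X_mul, hα1]
      simp
    refine ⟨?_, e2⟩
    rw [e1]
    -- Orthogonality to `Ψ_0(V) e = e` makes the first two entries of `(0, Ψ_{k+1}(V) e)` vanish,
    -- and `Θ(a)` is the identity on such vectors.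
    have h0 : szegoVec V (szego b (k + 1)).1 0 = 0 := by
      have := hV.orthogonal 0 (k + 1) (by omega) hk
      simpa [szego, szegoVec_one] using this
    obtain ⟨c, x, hcx⟩ : ∃ c x, szegoVec V (szego b (k + 1)).1 = Fin.cons c x :=
      ⟨_, _, (Fin.cons_self_tail _).symm⟩
    rw [hcx, Fin.cons_zero] at h0
    rw [hcx, h0, thetaBlock_mulVec]
    simp

theorem IsSzego.cons {m : ℕ} {V : Matrix (Fin (m + 1)) (Fin (m + 1)) ℂ} {a ρ : ℂ} (hρ : ρ ≠ 0)
    (h : a * starRingEnd ℂ a + ρ * ρ = 1) {b : ℕ → ℂ} (hV : IsSzego V b) :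
    IsSzego (thetaBlock a ρ * oneSum V) (fun i => Nat.casesOn i a b : ℕ → ℂ) := by
  have key := cons_zero_szegoVec h hV
  refine ⟨fun j k hjk hk => ?_, fun k hk => ?_⟩
  · obtain ⟨k, rfl⟩ : ∃ l, k = l + 1 := ⟨k - 1, by omega⟩
    rw [(key k (by omega)).1]
    rcases j with _ | j
    · simp [szego, szegoVec_one]
    · rw [(key j (by omega)).1]
      have := hV.orthogonal j k (by omega) (by omega)
      rw [star_smul, smul_dotProduct, dotProduct_smul]
      simp only [dotProduct, Pi.star_apply, Fin.sum_univ_succ, Fin.cons_zero, Fin.cons_succ,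
        mul_zero, zero_add] at this ⊢
      rw [this, smul_zero, smul_zero]
  · rcases k with _ | k
    · simp only [szego, szegoVec_one]
      intro h0
      simpa using congrFun h0 0
    · rw [(key k (by omega)).1, smul_ne_zero_iff]
      refine ⟨hρ, fun h0 => hV.ne_zero k (by omega) ?_⟩
      funext i
      simpa using congrFun h0 i.succ

/-- Base case: `Φ_1(M) e = (M_00 - conj a_0) e = 0`. -/
theorem isSzego_fin_one {M : Matrix (Fin 1) (Fin 1) ℂ} {a : ℕ → ℂ}
    (h : M 0 0 = starRingEnd ℂ (a 0)) : IsSzego M a := by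
  refine ⟨fun j k hjk hk => ?_, fun k hk => ?_⟩
  · obtain rfl : k = 1 := by omega
    obtain rfl : j = 0 := by omega
    simp only [szego, szegoVec_sub, szegoVec_C_mul, szegoVec_X_mul, szegoVec_one]
    simp [dotProduct, h]
  · obtain rfl : k = 0 := by omega
    simp only [szego, szegoVec_one]
    intro h0
    simpa using congrFun h0 0

/-! ### Orthogonal polynomials of a spectral measure -/

open scoped ComplexOrder in
theorem eq_zero_of_star_dotProduct_self {n : ℕ} {v : Fin n → ℂ} (h : star v ⬝ᵥ v = 0) : v = 0 :=
  dotProduct_star_self_eq_zero.1 h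

/-- On the circle `conj z = z⁻¹`, so inner products are finite combinations of moments. This serves
both the passage to matrices and measurability in `U`. -/
theorem polyInner_eq_sum (μ : Measure Circle) [IsFiniteMeasure μ] {N : ℕ} {f g : ℂ[X]}
    (hf : f.natDegree < N) (hg : g.natDegree < N) :
    polyInner μ f g = ∑ i ∈ Finset.range N, ∑ j ∈ Finset.range N,
      starRingEnd ℂ (f.coeff i) * g.coeff j * ∫ z : Circle, (z : ℂ) ^ ((j : ℤ) - (i : ℤ)) ∂μ := by
  have hint : ∀ k : ℤ, Integrable (fun z : Circle => (z : ℂ) ^ k) μ := fun k => by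
    have hc : Continuous fun z : Circle => (z : ℂ) ^ k := by
      have : (fun z : Circle => (z : ℂ) ^ k) = fun z : Circle => ((z ^ k : Circle) : ℂ) := by
        funext z; simp
      rw [this]
      exact continuous_subtype_val.comp (continuous_zpow k)
    exact (BoundedContinuousFunction.mkOfCompact ⟨_, hc⟩).integrable μ
  have hpt : ∀ z : Circle, starRingEnd ℂ (f.eval (z : ℂ)) * g.eval (z : ℂ) =
      ∑ i ∈ Finset.range N, ∑ j ∈ Finset.range N,
        starRingEnd ℂ (f.coeff i) * g.coeff j * (z : ℂ) ^ ((j : ℤ) - (i : ℤ)) := by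
    intro z
    rw [eval_eq_sum_range' hf, eval_eq_sum_range' hg, map_sum, Finset.sum_mul_sum]
    refine Finset.sum_congr rfl fun i _ => Finset.sum_congr rfl fun j _ => ?_
    rw [map_mul, map_pow, ← Circle.coe_inv_eq_conj, zpow_sub₀ (Circle.coe_ne_zero z), zpow_natCast,
      zpow_natCast, Circle.coe_inv, inv_pow]
    field_simp
  rw [polyInner]
  simp_rw [hpt]
  rw [integral_finsetSum _ fun i _ => integrable_finsetSum _ fun j _ => (hint _).const_mul _]
  refine Finset.sum_congr rfl fun i _ => ?_
  rw [integral_finsetSum _ fun j _ => (hint _).const_mul _]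
  exact Finset.sum_congr rfl fun j _ => integral_const_mul _ _

/-- The spectral measure of `U` at the first basis vector. -/
noncomputable abbrev spectralAt {m : ℕ} (U : Matrix.unitaryGroup (Fin (m + 1)) ℂ) :
    Measure Circle :=
  spectralMeasure U (Pi.single 0 1)

instance isFiniteMeasure_spectralAt {m : ℕ} (U : Matrix.unitaryGroup (Fin (m + 1)) ℂ) :
    IsFiniteMeasure (spectralAt U) :=
  (isSpectralMeasure_spectralMeasure U _).isFiniteMeasure

theorem moment_spectralAt {m : ℕ} (U : Matrix.unitaryGroup (Fin (m + 1)) ℂ) (k : ℤ) :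
    ∫ z : Circle, (z : ℂ) ^ k ∂(spectralAt U) = (U ^ k).1 0 0 := by
  rw [(isSpectralMeasure_spectralMeasure U _).moment k]
  have : star (Pi.single 0 1 : Fin (m + 1) → ℂ) = Pi.single 0 1 := by
    rw [← Pi.single_star, star_one]
  simp [this]

/-- Both sides are sesquilinear, and on monomials the identity is `(U ^ i)ᴴ U ^ j = U ^ (j - i)`. -/
theorem polyInner_spectralAt {m : ℕ} (U : Matrix.unitaryGroup (Fin (m + 1)) ℂ) (f g : ℂ[X]) :
    polyInner (spectralAt U) f g = star (szegoVec U.1 f) ⬝ᵥ szegoVec U.1 g := by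
  have hf : f.natDegree < max f.natDegree g.natDegree + 1 := by omega
  have hg : g.natDegree < max f.natDegree g.natDegree + 1 := by omega
  rw [polyInner_eq_sum _ hf hg, szegoVec, szegoVec, aeval_eq_sum_range' hf, aeval_eq_sum_range' hg,
    Matrix.sum_mulVec, Matrix.sum_mulVec, star_sum, sum_dotProduct]
  refine Finset.sum_congr rfl fun i _ => ?_
  rw [dotProduct_sum]
  refine Finset.sum_congr rfl fun j _ => ?_
  rw [Matrix.smul_mulVec, Matrix.smul_mulVec, star_smul, smul_dotProduct, dotProduct_smul,
    Matrix.star_mulVec, moment_spectralAt]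
  have h1 : (U ^ ((j : ℤ) - (i : ℤ))).1 = (U.1 ^ i)ᴴ * U.1 ^ j := by
    have : U ^ ((j : ℤ) - (i : ℤ)) = star (U ^ i) * U ^ j := by
      rw [Unitary.star_eq_inv, sub_eq_neg_add, zpow_add, zpow_neg, zpow_natCast, zpow_natCast]
    rw [this]
    rfl
  have hs : star (Pi.single 0 1 : Fin (m + 1) → ℂ) = Pi.single 0 1 := by
    rw [← Pi.single_star, star_one]
  rw [h1, ← Matrix.dotProduct_mulVec, Matrix.mulVec_mulVec, hs]
  simp [mul_assoc]

theorem monicOP_spec (μ : Measure Circle) (k : ℕ) :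
    (monicOP μ k).Monic ∧ (monicOP μ k).natDegree = k := by
  induction k using Nat.strong_induction_on with
  | _ k ih =>
    have hd : (∑ j : Fin k, C (polyInner μ (monicOP μ j) (X ^ k) /
        polyInner μ (monicOP μ j) (monicOP μ j)) * monicOP μ j).degree <
        ((X : ℂ[X]) ^ k).degree := by
      rw [degree_X_pow, degree_lt_iff_coeff_zero]
      intro l hl
      rw [finsetSum_coeff]
      refine Finset.sum_eq_zero fun j _ => ?_
      rw [coeff_C_mul, coeff_eq_zero_of_natDegree_lt, mul_zero]
      rw [(ih j j.2).2]
      omega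
    rw [monicOP]
    refine ⟨(monic_X_pow k).sub_of_left hd, ?_⟩
    rw [natDegree_eq_of_degree_eq (degree_sub_eq_left_of_degree_lt hd), natDegree_X_pow]

theorem exists_sum_of_monic_sequence (Φ : ℕ → ℂ[X]) (hΦ : ∀ k, (Φ k).Monic ∧ (Φ k).natDegree = k)
    (k : ℕ) (p : ℂ[X]) (hp : p.degree < (k : WithBot ℕ)) :
    ∃ c : ℕ → ℂ, p = ∑ j ∈ Finset.range k, C (c j) * Φ j := by
  induction k generalizing p with
  | zero => exact ⟨0, by simpa using hp⟩
  | succ k ih =>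
    have h1 : (p - C (p.coeff k) * Φ k).degree < (k : WithBot ℕ) := by
      rw [degree_lt_iff_coeff_zero] at hp ⊢
      intro l hl
      rw [coeff_sub, coeff_C_mul]
      rcases hl.eq_or_lt with rfl | hl
      · have := (hΦ k).1.coeff_natDegree
        rw [(hΦ k).2] at this
        simp [this]
      · rw [hp l hl, coeff_eq_zero_of_natDegree_lt ((hΦ k).2.trans_lt hl)]
        simp
    obtain ⟨c, hc⟩ := ih _ h1
    refine ⟨fun j => if j = k then p.coeff k else c j, ?_⟩
    simp only [Finset.sum_range_succ, ↓reduceIte]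
    rw [← sub_eq_iff_eq_add, hc]
    refine Finset.sum_congr rfl fun j hj => ?_
    rw [if_neg (Finset.mem_range.1 hj).ne]

theorem szegoVec_sum {m : ℕ} (M : Matrix (Fin (m + 1)) (Fin (m + 1)) ℂ) {ι : Type*} (s : Finset ι)
    (p : ι → ℂ[X]) : szegoVec M (∑ i ∈ s, p i) = ∑ i ∈ s, szegoVec M (p i) := by
  simp only [szegoVec, map_sum, Matrix.sum_mulVec]

/-- Expand `X ^ k - Φ_k` in the lower `Φ_j`; orthogonality forces the coefficients to be the
Gram–Schmidt quotients. Only the `Φ_j` with `j < k` need nonzero norm, so the top degree `k = m + 1`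
is included. -/
theorem IsSzego.monicOP_eq {m : ℕ} {U : Matrix.unitaryGroup (Fin (m + 1)) ℂ} {a : ℕ → ℂ}
    (h : IsSzego U.1 a) (k : ℕ) (hk : k ≤ m + 1) : monicOP (spectralAt U) k = (szego a k).1 := by
  induction k using Nat.strong_induction_on with
  | _ k ih =>
    have hspec := fun k => szego_spec a k
    have horth : ∀ i j, i ≠ j → i ≤ m + 1 → j ≤ m + 1 →
        star (szegoVec U.1 (szego a i).1) ⬝ᵥ szegoVec U.1 (szego a j).1 = 0 := by
      intro i j hij hi hj
      rcases lt_or_gt_of_ne hij with h' | h'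
      · exact h.orthogonal i j h' hj
      · rw [Matrix.star_dotProduct, h.orthogonal j i h' hi, star_zero]
    have hdeg : ((X : ℂ[X]) ^ k - (szego a k).1).degree < (k : WithBot ℕ) := by
      have := degree_sub_lt_left (p := (X : ℂ[X]) ^ k) (q := (szego a k).1)
        (by rw [degree_X_pow, degree_eq_natDegree (hspec k).1.ne_zero, (hspec k).2.1])
        (monic_X_pow k).ne_zero (by rw [monic_X_pow, (hspec k).1.leadingCoeff])
      rwa [degree_X_pow] at this
    obtain ⟨c, hc⟩ := exists_sum_of_monic_sequence (fun j => (szego a j).1)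
      (fun j => ⟨(hspec j).1, (hspec j).2.1⟩) k _ hdeg
    rw [monicOP, sub_eq_iff_eq_add, ← sub_eq_iff_eq_add', hc, Finset.sum_range]
    refine Finset.sum_congr rfl fun j _ => ?_
    rw [ih j j.2 (by omega)]
    congr 2
    have hne : star (szegoVec U.1 (szego a j).1) ⬝ᵥ szegoVec U.1 (szego a j).1 ≠ 0 := by
      intro h0
      exact h.ne_zero j (by omega) (eq_zero_of_star_dotProduct_self h0)
    rw [polyInner_spectralAt, polyInner_spectralAt, eq_div_iff hne]
    have hX : (X : ℂ[X]) ^ k = (szego a k).1 + ∑ j ∈ Finset.range k, C (c j) * (szego a j).1 := by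
      rw [← hc]; ring
    have hv : szegoVec U.1 (X ^ k) = szegoVec U.1 (szego a k).1 +
        ∑ j ∈ Finset.range k, c j • szegoVec U.1 (szego a j).1 := by
      have := congrArg (szegoVec U.1) hc
      rw [szegoVec_sub, sub_eq_iff_eq_add', szegoVec_sum] at this
      rw [this]
      simp only [szegoVec_C_mul]
    rw [hv, dotProduct_add, horth j k j.2.ne (by omega) hk, zero_add, dotProduct_sum,
      Finset.sum_eq_single (j : ℕ)]
    · rw [dotProduct_smul, smul_eq_mul]
    · intro i hi hij
      rw [Finset.mem_range] at hi
      rw [dotProduct_smul, horth j i hij.symm (by omega) (by omega), smul_zero]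
    · intro hj
      exact absurd (Finset.mem_range.2 j.2) hj

/-- The value `-conj (Φ_{k+1}(0))`, which is the only candidate for the `k`-th recurrence
coefficient. -/
noncomputable def recCoeff (μ : Measure Circle) (k : ℕ) : ℂ :=
  -starRingEnd ℂ ((monicOP μ (k + 1)).coeff 0)

/-- Evaluate the recurrence at `0`: since `Φ_k` is monic, `Φ_k^*(0) = 1`, leaving `Φ_{k+1}(0) =
-conj a`. -/
theorem IsRecurrenceCoeff.eq_recCoeff {μ : Measure Circle} {k : ℕ} {a : ℂ}
    (h : IsRecurrenceCoeff μ k a) : a = recCoeff μ k := by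
  have h1 := (monicOP_spec μ k).1.coeff_natDegree
  rw [(monicOP_spec μ k).2] at h1
  rw [recCoeff, h, coeff_sub, coeff_C_mul, coeff_reversedPoly]
  simp [h1]

theorem verblunsky_eq_recCoeff {μ : Measure Circle} {k : ℕ} {a : ℂ}
    (h : IsRecurrenceCoeff μ k a) : verblunsky μ k = recCoeff μ k := by
  have h' : ∃ a, IsRecurrenceCoeff μ k a := ⟨a, h⟩
  rw [verblunsky, dif_pos h']
  exact h'.choose_spec.eq_recCoeff

theorem IsSzego.isRecurrenceCoeff {m : ℕ} {U : Matrix.unitaryGroup (Fin (m + 1)) ℂ} {a : ℕ → ℂ}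
    (h : IsSzego U.1 a) (k : ℕ) (hk : k ≤ m) : IsRecurrenceCoeff (spectralAt U) k (a k) := by
  rw [IsRecurrenceCoeff, h.monicOP_eq k (by omega), h.monicOP_eq (k + 1) (by omega),
    ← (szego_spec a k).2.2, szego]

theorem szego_congr {a b : ℕ → ℂ} {k : ℕ} (h : ∀ i < k, a i = b i) : szego a k = szego b k := by
  induction k with
  | zero => rfl
  | succ k ih => rw [szego, szego, ih fun i hi => h i (by omega), h k (by omega)]

theorem IsSzego.congr {m : ℕ} {M : Matrix (Fin (m + 1)) (Fin (m + 1)) ℂ} {a b : ℕ → ℂ}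
    (h : IsSzego M a) (hab : ∀ i ≤ m, a i = b i) : IsSzego M b := by
  have key : ∀ k ≤ m + 1, szego a k = szego b k := fun k hk =>
    szego_congr fun i hi => hab i (by omega)
  refine ⟨fun j k hjk hk => ?_, fun k hk => ?_⟩
  · rw [← key j (by omega), ← key k hk]; exact h.orthogonal j k hjk hk
  · rw [← key k (by omega)]; exact h.ne_zero k hk

theorem IsSzego.eq_recCoeff {m : ℕ} {U : Matrix.unitaryGroup (Fin (m + 1)) ℂ} {a : ℕ → ℂ}
    (h : IsSzego U.1 a) (k : ℕ) (hk : k ≤ m) : a k = recCoeff (spectralAt U) k :=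
  (h.isRecurrenceCoeff k hk).eq_recCoeff

/-! ### Measurability -/

theorem measurable_coeff_szego {Ω : Type*} [MeasurableSpace Ω] {a : Ω → ℕ → ℂ}
    (ha : ∀ k, Measurable fun U => a U k) (k : ℕ) :
    (∀ l, Measurable fun U => (szego (a U) k).1.coeff l) ∧
      ∀ l, Measurable fun U => (szego (a U) k).2.coeff l := by
  induction k with
  | zero => exact ⟨fun _ => measurable_const, fun _ => measurable_const⟩
  | succ k ih =>
    have hX : ∀ l, Measurable fun U => (X * (szego (a U) k).1).coeff l := by
      intro l
      rcases l with _ | l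
      · simp
      · simpa only [coeff_X_mul] using ih.1 l
    simp only [szego, coeff_sub, coeff_C_mul]
    exact ⟨fun l => (hX l).sub ((RCLike.continuous_conj.measurable.comp (ha k)).mul (ih.2 l)),
      fun l => (ih.2 l).sub ((ha k).mul (hX l))⟩

section Measurability

variable {m : ℕ} [MeasurableSpace (Matrix.unitaryGroup (Fin (m + 1)) ℂ)]
  [BorelSpace (Matrix.unitaryGroup (Fin (m + 1)) ℂ)]

theorem measurable_polyInner {N : ℕ} {f g : Matrix.unitaryGroup (Fin (m + 1)) ℂ → ℂ[X]}
    (hf : ∀ l, Measurable fun U => (f U).coeff l) (hg : ∀ l, Measurable fun U => (g U).coeff l)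
    (hfN : ∀ U, (f U).natDegree < N) (hgN : ∀ U, (g U).natDegree < N) :
    Measurable fun U => polyInner (spectralAt U) (f U) (g U) := by
  simp_rw [fun U => polyInner_eq_sum (spectralAt U) (hfN U) (hgN U), moment_spectralAt]
  refine Finset.measurable_sum _ fun i _ => Finset.measurable_sum _ fun j _ => ?_
  refine (((RCLike.continuous_conj.measurable.comp (hf i))).mul (hg j)).mul ?_
  refine Continuous.measurable ?_
  exact (continuous_subtype_val.comp (continuous_zpow _)).matrix_elem 0 0

/-- Gram–Schmidt coefficients are quotients of measurable functions. Since `x / 0 = 0`, this covers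
also those `U` for which a norm vanishes. -/
theorem measurable_coeff_monicOP (k l : ℕ) :
    Measurable fun U : Matrix.unitaryGroup (Fin (m + 1)) ℂ =>
      (monicOP (spectralAt U) k).coeff l := by
  induction k using Nat.strong_induction_on generalizing l with
  | _ k ih =>
    have : (fun U : Matrix.unitaryGroup (Fin (m + 1)) ℂ => (monicOP (spectralAt U) k).coeff l) =
        fun U => ((X : ℂ[X]) ^ k).coeff l - ∑ j : Fin k,
          polyInner (spectralAt U) (monicOP (spectralAt U) j) (X ^ k) /
            polyInner (spectralAt U) (monicOP (spectralAt U) j) (monicOP (spectralAt U) j) *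
              (monicOP (spectralAt U) j).coeff l := by
      funext U
      rw [monicOP, coeff_sub, finsetSum_coeff]
      simp only [coeff_C_mul]
    rw [this]
    refine measurable_const.sub (Finset.measurable_sum _ fun j _ => ?_)
    have hd : ∀ U : Matrix.unitaryGroup (Fin (m + 1)) ℂ,
        (monicOP (spectralAt U) j).natDegree < k + 1 := fun U => by
      rw [(monicOP_spec _ _).2]; omega
    refine ((measurable_polyInner (ih j j.2) (fun _ => measurable_const) hd ?_).div
      (measurable_polyInner (ih j j.2) (ih j j.2) hd hd)).mul (ih j j.2 l)
    intro U
    rw [natDegree_X_pow]; omega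

theorem measurable_recCoeff (k : ℕ) :
    Measurable fun U : Matrix.unitaryGroup (Fin (m + 1)) ℂ => recCoeff (spectralAt U) k :=
  (RCLike.continuous_conj.measurable.comp (measurable_coeff_monicOP (k + 1) 0)).neg

/-- By `polyInner_spectralAt` the set is cut out by countably many equations and inequations between
measurable functions. It is needed because the almost sure statement is proved by integrating the
indicator of the complement. -/
theorem measurableSet_isSzego :
    MeasurableSet {U : Matrix.unitaryGroup (Fin (m + 1)) ℂ |
      IsSzego U.1 (recCoeff (spectralAt U))} := by
  have h : {U : Matrix.unitaryGroup (Fin (m + 1)) ℂ | IsSzego U.1 (recCoeff (spectralAt U))} =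
      {U | (∀ j k, j < k → k ≤ m + 1 → polyInner (spectralAt U)
        (szego (recCoeff (spectralAt U)) j).1 (szego (recCoeff (spectralAt U)) k).1 = 0) ∧
        ∀ k ≤ m, ¬ polyInner (spectralAt U)
        (szego (recCoeff (spectralAt U)) k).1 (szego (recCoeff (spectralAt U)) k).1 = 0} := by
    ext U
    simp only [Set.mem_ofPred_eq, polyInner_spectralAt]
    refine ⟨fun h => ⟨h.orthogonal, fun k hk h0 => h.ne_zero k hk ?_⟩,
      fun h => ⟨h.1, fun k hk h0 => h.2 k hk ?_⟩⟩
    · exact eq_zero_of_star_dotProduct_self h0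
    · rw [h0, dotProduct_zero]
  have hm : ∀ j k, Measurable fun U : Matrix.unitaryGroup (Fin (m + 1)) ℂ =>
      polyInner (spectralAt U) (szego (recCoeff (spectralAt U)) j).1
        (szego (recCoeff (spectralAt U)) k).1 := fun j k =>
    measurable_polyInner (N := j + k + 1) (measurable_coeff_szego measurable_recCoeff j).1
      (measurable_coeff_szego measurable_recCoeff k).1
      (fun U => by rw [(szego_spec _ _).2.1]; omega) (fun U => by rw [(szego_spec _ _).2.1]; omega)
  rw [h]
  have h0 : ∀ j k, MeasurableSet {U : Matrix.unitaryGroup (Fin (m + 1)) ℂ |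
      polyInner (spectralAt U) (szego (recCoeff (spectralAt U)) j).1
        (szego (recCoeff (spectralAt U)) k).1 = 0} := fun j k =>
    measurableSet_eq_fun (hm j k) measurable_const
  simp only [Set.ofPred_and, Set.ofPred_forall]
  refine MeasurableSet.inter ?_ ?_
  · exact MeasurableSet.iInter fun j => MeasurableSet.iInter fun k => MeasurableSet.iInter fun _ =>
      MeasurableSet.iInter fun _ => h0 j k
  · exact MeasurableSet.iInter fun k => MeasurableSet.iInter fun _ => (h0 k k).compl

end Measurability

/-! ### Conjugation -/

/-- The block matrix fixes `e`, so the `(0, 0)` entries of all powers, which are the moments, are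
unchanged. -/
theorem spectralAt_conj_unitarySum {m : ℕ} (U : Matrix.unitaryGroup (Fin (m + 1)) ℂ)
    (W : Matrix.unitaryGroup (Fin m) ℂ) :
    spectralAt (unitarySum W * U * (unitarySum W)⁻¹) = spectralAt U := by
  refine circle_measure_ext fun k => ?_
  rw [moment_spectralAt, moment_spectralAt, conj_zpow, ← map_inv]
  have h1 : ∀ (V : Matrix.unitaryGroup (Fin m) ℂ) (M : Matrix (Fin (m + 1)) (Fin (m + 1)) ℂ) j,
      (oneSum V.1 * M) 0 j = M 0 j := by
    intro V M j
    simp [oneSum, Matrix.mul_apply, Fin.sum_univ_succ]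
  have h2 : ∀ (V : Matrix.unitaryGroup (Fin m) ℂ) (M : Matrix (Fin (m + 1)) (Fin (m + 1)) ℂ) j,
      (M * oneSum V.1) j 0 = M j 0 := by
    intro V M j
    simp [oneSum, Matrix.mul_apply, Fin.sum_univ_succ]
  change (oneSum W.1 * (U ^ k).1 * oneSum (W⁻¹).1) 0 0 = _
  rw [h2, h1]

/-! ### The unitary group -/

instance compactSpace_unitaryGroup (n : ℕ) : CompactSpace (Matrix.unitaryGroup (Fin n) ℂ) := by
  refine isCompact_iff_compactSpace.1
    (?_ : IsCompact (Matrix.unitaryGroup (Fin n) ℂ : Set (Matrix (Fin n) (Fin n) ℂ)))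
  have hK : IsCompact (Set.univ.pi fun _ : Fin n => Set.univ.pi fun _ : Fin n =>
      Metric.closedBall (0 : ℂ) 1) :=
    isCompact_univ_pi fun _ => isCompact_univ_pi fun _ => isCompact_closedBall _ _
  refine IsCompact.of_isClosed_subset (X := Matrix (Fin n) (Fin n) ℂ) hK isClosed_unitary ?_
  intro U hU i _ j _
  simpa using entry_norm_bound_of_unitary hU i j

instance secondCountableTopology_unitaryGroup (n : ℕ) :
    SecondCountableTopology (Matrix.unitaryGroup (Fin n) ℂ) := by
  have : SecondCountableTopology (Matrix (Fin n) (Fin n) ℂ) :=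
    inferInstanceAs (SecondCountableTopology (Fin n → Fin n → ℂ))
  exact TopologicalSpace.Subtype.secondCountableTopology _

/-- A right translate of `μ` is again a Haar probability measure, hence equals `μ` by uniqueness. -/
theorem isMulRightInvariant_of_isProbabilityMeasure {G : Type*} [Group G] [TopologicalSpace G]
    [IsTopologicalGroup G] [LocallyCompactSpace G] [MeasurableSpace G] [BorelSpace G]
    (μ : Measure G) [μ.IsHaarMeasure] [IsProbabilityMeasure μ] : μ.IsMulRightInvariant := by
  refine ⟨fun g => ?_⟩
  have : IsProbabilityMeasure (μ.map (· * g)) :=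
    Measure.isProbabilityMeasure_map (by fun_prop)
  exact Measure.isHaarMeasure_eq_of_isProbabilityMeasure _ _

theorem exists_isHaarMeasure_isProbabilityMeasure (G : Type*) [Group G] [TopologicalSpace G]
    [IsTopologicalGroup G] [CompactSpace G] [MeasurableSpace G] [BorelSpace G] :
    ∃ μ : Measure G, μ.IsHaarMeasure ∧ IsProbabilityMeasure μ :=
  ⟨Measure.haarMeasure ⊤, inferInstance, ⟨by
    simpa using Measure.haarMeasure_self (K₀ := (⊤ : TopologicalSpace.PositiveCompacts G))⟩⟩

/-- Complete `w` to an orthonormal basis and use it as columns. -/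
theorem exists_unitary_mulVec_single {m : ℕ} {w : Fin (m + 1) → ℂ} (hw : star w ⬝ᵥ w = 1) :
    ∃ W : Matrix.unitaryGroup (Fin (m + 1)) ℂ, W.1 *ᵥ Pi.single 0 1 = w := by
  let w' : EuclideanSpace ℂ (Fin (m + 1)) := WithLp.toLp 2 w
  have hw' : ‖w'‖ = 1 := by
    have h1 : inner ℂ w' w' = (1 : ℂ) := by
      rw [EuclideanSpace.inner_toLp_toLp, dotProduct_comm]
      exact hw
    rw [inner_self_eq_norm_sq_to_K] at h1
    have h2 : ‖w'‖ ^ 2 = 1 := by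
      rw [← Complex.ofReal_inj]
      simpa using h1
    exact (pow_eq_one_iff_of_nonneg (norm_nonneg _) two_ne_zero).1 h2
  obtain ⟨b, hb⟩ := Orthonormal.exists_orthonormalBasis_extension_of_card_eq (𝕜 := ℂ)
    (E := EuclideanSpace ℂ (Fin (m + 1))) (ι := Fin (m + 1)) (by simp) (v := fun _ => w')
    (s := {0}) (by
      refine ⟨fun i => hw', fun i j hij => ?_⟩
      exact absurd (Subsingleton.elim i j) hij)
  refine ⟨⟨_, (EuclideanSpace.basisFun (Fin (m + 1)) ℂ).toMatrix_orthonormalBasis_mem_unitary b⟩, ?_⟩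
  funext i
  have := hb 0 rfl
  simp [Module.Basis.toMatrix_apply, this, w']

theorem eq_unitarySum_of_mulVec_single {m : ℕ} {Y : Matrix.unitaryGroup (Fin (m + 1)) ℂ}
    (hY : Y.1 *ᵥ Pi.single 0 1 = Pi.single 0 1) : ∃ V, Y = unitarySum V := by
  have hs : (star Y.1) *ᵥ Pi.single 0 1 = Pi.single 0 1 := by
    conv_lhs => rw [← hY]
    rw [Matrix.mulVec_mulVec, Matrix.mem_unitaryGroup_iff'.1 Y.2, Matrix.one_mulVec]
  have hc : ∀ i, Y.1 i 0 = (Pi.single 0 1 : Fin (m + 1) → ℂ) i := fun i => by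
    rw [← hY]; simp
  have hr : ∀ i, Y.1 0 i = (Pi.single 0 1 : Fin (m + 1) → ℂ) i := fun i => by
    have := congrArg (starRingEnd ℂ) (congrFun hs i)
    simp [Matrix.star_apply] at this
    rw [this]
    rcases eq_or_ne i 0 with rfl | hi <;> simp [*]
  have hV : Y.1 = oneSum (Y.1.submatrix Fin.succ Fin.succ) := by
    ext i j
    refine Fin.cases ?_ (fun i => ?_) i
    · refine Fin.cases ?_ (fun j => ?_) j <;> simp [oneSum, hr]
    · refine Fin.cases ?_ (fun j => ?_) j <;> simp [oneSum, hc]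
  have hinj : Function.Injective (oneSum : Matrix (Fin m) (Fin m) ℂ → _) := by
    intro A B hAB
    ext i j
    simpa [oneSum] using congrFun (congrFun hAB i.succ) j.succ
  refine ⟨⟨Y.1.submatrix Fin.succ Fin.succ, ?_⟩, Subtype.ext hV⟩
  rw [Matrix.mem_unitaryGroup_iff]
  apply hinj
  rw [oneSum_mul, oneSum_star, ← hV, oneSum_one, Matrix.mem_unitaryGroup_iff.1 Y.2]

/-- The first column of `U` is `(c, r w)` with `w` a unit vector and `r = √(1 - |c|²)`. If `W e =
w`, then `(1 ⊕ W) T` has the same first column, so `((1 ⊕ W) T)⁻¹ U` fixes `e` and is of the form `1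
⊕ V`. -/
theorem exists_decomposition {m : ℕ} (U : Matrix.unitaryGroup (Fin (m + 2)) ℂ)
    (hU : ‖U.1 0 0‖ < 1) :
    ∃ (T : Matrix.unitaryGroup (Fin (m + 2)) ℂ) (V W : Matrix.unitaryGroup (Fin (m + 1)) ℂ)
      (ρ : ℂ), ρ ≠ 0 ∧
      starRingEnd ℂ (U.1 0 0) * starRingEnd ℂ (starRingEnd ℂ (U.1 0 0)) + ρ * ρ = 1 ∧
      T.1 = thetaBlock (starRingEnd ℂ (U.1 0 0)) ρ ∧ U = unitarySum W * T * unitarySum V := by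
  set c : ℂ := U.1 0 0 with hc
  set r : ℝ := Real.sqrt (1 - ‖c‖ ^ 2) with hr
  have hpos : 0 < 1 - ‖c‖ ^ 2 := by
    have := norm_nonneg c
    nlinarith
  have hr0 : (r : ℂ) ≠ 0 := by
    exact_mod_cast (Real.sqrt_pos.2 hpos).ne'
  have hcc : c * starRingEnd ℂ c = ((‖c‖ ^ 2 : ℝ) : ℂ) := by
    rw [Complex.mul_conj, Complex.normSq_eq_norm_sq]
  have hrr : (r : ℂ) * r = 1 - c * starRingEnd ℂ c := by
    rw [hcc, ← Complex.ofReal_mul, Real.mul_self_sqrt hpos.le]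
    push_cast; ring
  have hsum : starRingEnd ℂ c * starRingEnd ℂ (starRingEnd ℂ c) + r * r = 1 := by
    rw [hrr, Complex.conj_conj]; ring
  set T : Matrix.unitaryGroup (Fin (m + 2)) ℂ := ⟨thetaBlock (starRingEnd ℂ c) r,
    Matrix.mem_unitaryGroup_iff.2 (thetaBlock_mul_star (Complex.conj_ofReal r) hsum)⟩ with hT
  have hsingle : ∀ n, (Pi.single 0 1 : Fin (n + 1) → ℂ) = Fin.cons 1 0 := by
    intro n; funext i; refine Fin.cases ?_ (fun i => ?_) i <;> simp
  have hz : ∀ n, (0 : Fin (n + 1) → ℂ) = Fin.cons 0 0 := by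
    intro n; funext i; refine Fin.cases ?_ (fun i => ?_) i <;> simp
  set w : Fin (m + 1) → ℂ := fun i => (r : ℂ)⁻¹ * U.1 i.succ 0 with hw
  have hcol : ∑ i, starRingEnd ℂ (U.1 i 0) * U.1 i 0 = 1 := by
    have := congrFun (congrFun (Matrix.mem_unitaryGroup_iff'.1 U.2) 0) 0
    simpa [Matrix.mul_apply, Matrix.star_apply] using this
  have hww : star w ⬝ᵥ w = 1 := by
    rw [Fin.sum_univ_succ] at hcol
    have h2 : ∑ i : Fin (m + 1), starRingEnd ℂ (U.1 i.succ 0) * U.1 i.succ 0 = r * r := by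
      rw [hrr]
      linear_combination hcol
    have h3 : star w ⬝ᵥ w = ((r : ℂ)⁻¹ * (r : ℂ)⁻¹) *
        ∑ i : Fin (m + 1), starRingEnd ℂ (U.1 i.succ 0) * U.1 i.succ 0 := by
      simp only [dotProduct, hw, Pi.star_apply, RCLike.star_def, map_mul, map_inv₀,
        Complex.conj_ofReal, Finset.mul_sum]
      exact Finset.sum_congr rfl fun i _ => by ring
    rw [h3, h2]
    field_simp
  obtain ⟨W, hW⟩ := exists_unitary_mulVec_single hww
  have hUe : (unitarySum W * T).1 *ᵥ Pi.single 0 1 = U.1 *ᵥ Pi.single 0 1 := by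
    change (oneSum W.1 * thetaBlock (starRingEnd ℂ c) r) *ᵥ Pi.single 0 1 = _
    rw [← Matrix.mulVec_mulVec, hsingle, hz, thetaBlock_mulVec, oneSum_mulVec_cons]
    have h1 : (Fin.cons ((r : ℂ) * 1 - starRingEnd ℂ c * 0) 0 : Fin (m + 1) → ℂ) =
        (r : ℂ) • Pi.single 0 1 := by
      rw [hsingle]
      funext i; refine Fin.cases ?_ (fun i => ?_) i <;> simp
    rw [h1, Matrix.mulVec_smul, hW, ← hz, ← hsingle]
    funext i
    refine Fin.cases ?_ (fun i => ?_) i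
    · simp [hc]
    · simp [hw, hr0]
  obtain ⟨V, hV⟩ := eq_unitarySum_of_mulVec_single (Y := (unitarySum W * T)⁻¹ * U) (by
    change ((unitarySum W * T)⁻¹.1 * U.1) *ᵥ Pi.single 0 1 = _
    rw [← Matrix.mulVec_mulVec, ← hUe, Matrix.mulVec_mulVec]
    change ((unitarySum W * T)⁻¹ * (unitarySum W * T)).1 *ᵥ Pi.single 0 1 = _
    rw [inv_mul_cancel]
    exact Matrix.one_mulVec _)
  refine ⟨T, V, W, r, hr0, hsum, rfl, ?_⟩
  rw [← hV, mul_inv_cancel_left]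

/-! ### One step of the recursion -/

theorem isSzego_iff_of_spectralAt_eq {m : ℕ} {U V : Matrix.unitaryGroup (Fin (m + 1)) ℂ}
    (h : spectralAt U = spectralAt V) (a : ℕ → ℂ) : IsSzego U.1 a → IsSzego V.1 a := by
  intro hU
  refine ⟨fun j k hjk hk => ?_, fun k hk h0 => ?_⟩
  · rw [← polyInner_spectralAt, ← h, polyInner_spectralAt]
    exact hU.orthogonal j k hjk hk
  · have h1 : polyInner (spectralAt V) (szego a k).1 (szego a k).1 = 0 := by
      rw [polyInner_spectralAt, h0, dotProduct_zero]
    rw [← h, polyInner_spectralAt] at h1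
    exact hU.ne_zero k hk (eq_zero_of_star_dotProduct_self h1)

/-- With `U = (1 ⊕ W) T (1 ⊕ V₀)`, the matrix `U (1 ⊕ V)` is conjugate under `1 ⊕ W` to `T (1 ⊕ V₀ V
W)`; thus `g = V₀` and `h = W`, both independent of `V`. -/
theorem exists_right_translate {m : ℕ} (U : Matrix.unitaryGroup (Fin (m + 2)) ℂ)
    (hU : ‖U.1 0 0‖ < 1) :
    ∃ g h : Matrix.unitaryGroup (Fin (m + 1)) ℂ, ∀ V : Matrix.unitaryGroup (Fin (m + 1)) ℂ,
      IsSzego (g * V * h).1 (recCoeff (spectralAt (g * V * h))) →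
      IsSzego (U * unitarySum V).1 (recCoeff (spectralAt (U * unitarySum V))) ∧
      (fun k : Fin (m + 2) => recCoeff (spectralAt (U * unitarySum V)) k) =
        (Fin.cons (starRingEnd ℂ (U.1 0 0))
          fun k : Fin (m + 1) => recCoeff (spectralAt (g * V * h)) k : Fin (m + 2) → ℂ) := by
  obtain ⟨T, V₀, W, ρ, hρ, hsum, hT, hdec⟩ := exists_decomposition U hU
  refine ⟨V₀, W, fun V hV => ?_⟩
  have h1 : spectralAt (T * unitarySum (V₀ * V * W)) = spectralAt (U * unitarySum V) := by
    rw [← spectralAt_conj_unitarySum (T * unitarySum (V₀ * V * W)) W, hdec, map_mul, map_mul]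
    congr 1
    group
  have h2 : IsSzego (T * unitarySum (V₀ * V * W)).1
      (fun i => Nat.casesOn i (starRingEnd ℂ (U.1 0 0)) (recCoeff (spectralAt (V₀ * V * W)))) := by
    have := hV.cons hρ hsum
    rwa [← hT] at this
  have h3 := isSzego_iff_of_spectralAt_eq h1 _ h2
  refine ⟨h3.congr h3.eq_recCoeff, ?_⟩
  funext k
  rw [← h3.eq_recCoeff k (by omega)]
  refine Fin.cases ?_ (fun k => ?_) k <;> simp

/-! ### Integrals over the disk in polar coordinates -/

theorem lintegral_polar {h : ℂ → ENNReal} (hh : Measurable h) :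
    ∫⁻ z, h z = ∫⁻ r in Set.Ioi (0 : ℝ), ENNReal.ofReal r *
      ∫⁻ θ in Set.Ioo (-Real.pi) Real.pi, h (r * Complex.exp (θ * Complex.I)) := by
  rw [← Complex.lintegral_comp_polarCoord_symm, polarCoord_target, Measure.volume_eq_prod,
    ← Measure.prod_restrict]
  have hm : Measurable fun p : ℝ × ℝ => h (p.1 * Complex.exp (p.2 * Complex.I)) :=
    hh.comp (by fun_prop)
  have he : ∀ p : ℝ × ℝ, ENNReal.ofReal p.1 • h (Complex.polarCoord.symm p) =
      ENNReal.ofReal p.1 * h (p.1 * Complex.exp (p.2 * Complex.I)) := by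
    intro p
    rw [Complex.polarCoord_symm_apply, smul_eq_mul, Complex.exp_mul_I]
    push_cast
    rfl
  simp_rw [he]
  rw [lintegral_prod _ (by fun_prop)]
  refine lintegral_congr fun r => ?_
  have hr : Measurable fun θ : ℝ => h (r * Complex.exp (θ * Complex.I)) := hh.comp (by fun_prop)
  dsimp only
  rw [lintegral_const_mul _ hr]

theorem norm_mul_exp_of_pos {r : ℝ} (hr : 0 < r) (θ : ℝ) :
    ‖(r : ℂ) * Complex.exp (θ * Complex.I)‖ = r := by
  rw [norm_mul, Complex.norm_exp_ofReal_mul_I, mul_one, Complex.norm_real, Real.norm_of_nonneg hr.le]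

/-- A radial weight on the unit disk, in polar coordinates. -/
theorem lintegral_ball_polar (p : ℕ) {g : ℂ → ENNReal} (hg : Measurable g) :
    ∫⁻ z in Metric.ball (0 : ℂ) 1, ENNReal.ofReal ((1 - ‖z‖ ^ 2) ^ p) * g z =
      ∫⁻ r in Set.Ioo (0 : ℝ) 1, ENNReal.ofReal (r * (1 - r ^ 2) ^ p) *
        ∫⁻ θ in Set.Ioo (-Real.pi) Real.pi, g (r * Complex.exp (θ * Complex.I)) := by
  have hmeas : Measurable fun z : ℂ => ENNReal.ofReal ((1 - ‖z‖ ^ 2) ^ p) * g z := by fun_prop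
  rw [← lintegral_indicator Metric.isOpen_ball.measurableSet,
    lintegral_polar (hmeas.indicator Metric.isOpen_ball.measurableSet)]
  have hI : Set.Ioo (0 : ℝ) 1 = Set.Ioi 0 ∩ Set.Iio 1 := rfl
  rw [hI, Set.inter_comm, ← setLIntegral_indicator measurableSet_Iio]
  refine setLIntegral_congr_fun measurableSet_Ioi fun r hr => ?_
  rw [Set.mem_Ioi] at hr
  by_cases h1 : r < 1
  · rw [Set.indicator_of_mem (Set.mem_Iio.2 h1), ENNReal.ofReal_mul hr.le, mul_assoc]
    congr 1
    rw [← lintegral_const_mul _ (by fun_prop)]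
    refine lintegral_congr fun θ => ?_
    rw [Set.indicator_of_mem (by rw [mem_ball_zero_iff, norm_mul_exp_of_pos hr]; exact h1),
      norm_mul_exp_of_pos hr]
  · rw [Set.indicator_of_notMem (by simpa using h1)]
    have : ∀ θ : ℝ, (Metric.ball (0 : ℂ) 1).indicator
        (fun z : ℂ => ENNReal.ofReal ((1 - ‖z‖ ^ 2) ^ p) * g z) (r * Complex.exp (θ * Complex.I)) =
        0 := fun θ => Set.indicator_of_notMem
      (by rw [mem_ball_zero_iff, norm_mul_exp_of_pos hr]; exact h1) _
    simp [this]

theorem lintegral_Ioo_mul_pow (p : ℕ) :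
    ∫⁻ r in Set.Ioo (0 : ℝ) 1, ENNReal.ofReal (r * (1 - r ^ 2) ^ p) =
      ENNReal.ofReal (1 / (2 * (p + 1))) := by
  have hder : ∀ x : ℝ, HasDerivAt (fun r : ℝ => -(1 - r ^ 2) ^ (p + 1) / (2 * (p + 1)))
      (x * (1 - x ^ 2) ^ p) x := by
    intro x
    have := ((((hasDerivAt_id x).pow 2).const_sub 1).pow (p + 1)).neg.div_const (2 * ((p : ℝ) + 1))
    refine this.congr_deriv ?_
    simp
    field_simp
  have hcont : Continuous fun r : ℝ => r * (1 - r ^ 2) ^ p := by fun_prop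
  have hint := intervalIntegral.integral_eq_sub_of_hasDerivAt (a := 0) (b := 1)
    (fun x _ => hder x) (hcont.intervalIntegrable 0 1)
  rw [intervalIntegral.integral_of_le zero_le_one, integral_Ioc_eq_integral_Ioo] at hint
  rw [← ofReal_integral_eq_lintegral_ofReal, hint]
  · congr 1
    simp
    field_simp
  · exact (hcont.integrableOn_Icc (a := 0) (b := 1)).mono_set Set.Ioo_subset_Icc_self
  · refine (ae_restrict_iff' measurableSet_Ioo).2 (Filter.Eventually.of_forall fun r hr => ?_)
    have h1 : 0 ≤ 1 - r ^ 2 := by nlinarith [hr.1, hr.2]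
    exact mul_nonneg hr.1.le (pow_nonneg h1 p)

theorem lintegral_ball_pow (p : ℕ) :
    ∫⁻ z in Metric.ball (0 : ℂ) 1, ENNReal.ofReal ((1 - ‖z‖ ^ 2) ^ p) =
      ENNReal.ofReal (Real.pi / (p + 1)) := by
  have := lintegral_ball_polar p (g := fun _ => 1) measurable_const
  simp only [mul_one] at this
  rw [this, lintegral_mul_const _ (by fun_prop), lintegral_Ioo_mul_pow, setLIntegral_one,
    Real.volume_Ioo, ← ENNReal.ofReal_mul (by positivity)]
  congr 1
  field_simp
  ring

theorem image_div_sqrt : (fun s : ℝ => s / √(1 - s ^ 2)) '' Set.Ioo 0 1 = Set.Ioi 0 := by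
  ext r
  constructor
  · rintro ⟨s, hs, rfl⟩
    have : 0 < 1 - s ^ 2 := by nlinarith [hs.1, hs.2]
    exact div_pos hs.1 (Real.sqrt_pos.2 this)
  · intro hr
    rw [Set.mem_Ioi] at hr
    have h1 : 0 < 1 + r ^ 2 := by positivity
    have hs := Real.sqrt_pos.2 h1
    have hlt : r < √(1 + r ^ 2) := by
      rw [Real.lt_sqrt hr.le]; linarith
    refine ⟨r / √(1 + r ^ 2), ⟨div_pos hr hs, (div_lt_one hs).2 hlt⟩, ?_⟩
    have h2 : 1 - (r / √(1 + r ^ 2)) ^ 2 = (1 / √(1 + r ^ 2)) ^ 2 := by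
      rw [div_pow, div_pow, Real.sq_sqrt h1.le]
      field_simp
      ring
    change r / √(1 + r ^ 2) / √(1 - (r / √(1 + r ^ 2)) ^ 2) = r
    rw [h2, Real.sqrt_sq (by positivity)]
    field_simp

/-- Substitute `r = s / √(1 - s²)`, with inverse `s = r / √(1 + r²)`. Then `1 + r² = 1 / (1 - s²)`
and `dr = (1 - s²)^(-3/2) ds`, so the powers combine to `s (1 - s²) ^ p`. -/
theorem lintegral_Ioi_comp_div_sqrt (p : ℕ) (G : ℝ → ENNReal) :
    ∫⁻ r in Set.Ioi (0 : ℝ), ENNReal.ofReal (r * ((1 + r ^ 2) ^ (p + 2))⁻¹) * G (r / √(1 + r ^ 2)) =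
      ∫⁻ s in Set.Ioo (0 : ℝ) 1, ENNReal.ofReal (s * (1 - s ^ 2) ^ p) * G s := by
  have hpos : ∀ s ∈ Set.Ioo (0 : ℝ) 1, 0 < 1 - s ^ 2 := fun s hs => by nlinarith [hs.1, hs.2]
  have hder : ∀ s ∈ Set.Ioo (0 : ℝ) 1, HasDerivAt (fun s : ℝ => s / √(1 - s ^ 2))
      (1 / ((1 - s ^ 2) * √(1 - s ^ 2))) s := by
    intro s hs
    have h0 := hpos s hs
    have hs0 := Real.sqrt_pos.2 h0
    have := (hasDerivAt_id s).div ((((hasDerivAt_id s).pow 2).const_sub 1).sqrt h0.ne') hs0.ne'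
    refine this.congr_deriv ?_
    have hsq := Real.sq_sqrt h0.le
    simp only [id]
    simp
    rw [hsq]
    field_simp
    rw [hsq]
    ring
  have hinv : ∀ s ∈ Set.Ioo (0 : ℝ) 1, 1 + (s / √(1 - s ^ 2)) ^ 2 = 1 / (1 - s ^ 2) := by
    intro s hs
    have h0 := hpos s hs
    rw [div_pow, Real.sq_sqrt h0.le]
    field_simp
    ring
  have hback : ∀ s ∈ Set.Ioo (0 : ℝ) 1,
      s / √(1 - s ^ 2) / √(1 + (s / √(1 - s ^ 2)) ^ 2) = s := by
    intro s hs
    have hs0 := Real.sqrt_pos.2 (hpos s hs)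
    rw [hinv s hs, Real.sqrt_div zero_le_one, Real.sqrt_one]
    field_simp
  have hinj : Set.InjOn (fun s : ℝ => s / √(1 - s ^ 2)) (Set.Ioo 0 1) := by
    intro s hs t ht hst
    change s / √(1 - s ^ 2) = t / √(1 - t ^ 2) at hst
    rw [← hback s hs, hst, hback t ht]
  rw [← image_div_sqrt, lintegral_image_eq_lintegral_abs_deriv_mul measurableSet_Ioo
    (fun s hs => (hder s hs).hasDerivWithinAt) hinj]
  refine setLIntegral_congr_fun measurableSet_Ioo fun s hs => ?_
  have h0 := hpos s hs
  have hs0 := Real.sqrt_pos.2 h0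
  rw [hback s hs, hinv s hs, ← mul_assoc, ← ENNReal.ofReal_mul (abs_nonneg _),
    abs_of_pos (by positivity)]
  congr 2
  have hsq := Real.sq_sqrt h0.le
  generalize 1 - s ^ 2 = q at *
  generalize √q = r at *
  subst hsq
  simp only [one_div, inv_pow, inv_inv]
  field_simp
  ring

theorem lintegral_comp_div_sqrt (p : ℕ) {g : ℂ → ENNReal} (hg : Measurable g) :
    ∫⁻ t : ℂ, ENNReal.ofReal (((1 + ‖t‖ ^ 2) ^ (p + 2))⁻¹) * g (t / (√(1 + ‖t‖ ^ 2) : ℝ)) =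
      ∫⁻ z in Metric.ball (0 : ℂ) 1, ENNReal.ofReal ((1 - ‖z‖ ^ 2) ^ p) * g z := by
  rw [lintegral_ball_polar p hg, lintegral_polar (by fun_prop),
    ← lintegral_Ioi_comp_div_sqrt p
      (fun r => ∫⁻ θ in Set.Ioo (-Real.pi) Real.pi, g (r * Complex.exp (θ * Complex.I)))]
  refine setLIntegral_congr_fun measurableSet_Ioi fun r hr => ?_
  rw [Set.mem_Ioi] at hr
  rw [ENNReal.ofReal_mul hr.le, mul_assoc]
  congr 1
  rw [← lintegral_const_mul _ (by fun_prop)]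
  refine lintegral_congr fun θ => ?_
  rw [norm_mul_exp_of_pos hr]
  congr 2
  push_cast
  ring

/-! ### The law of the first entry of a Haar unitary matrix -/

/-- The squared Euclidean norm. -/
noncomputable def sqNorm {n : ℕ} (x : Fin n → ℂ) : ℝ := ∑ i, ‖x i‖ ^ 2

section sqNorm

variable {n : ℕ}

theorem sqNorm_nonneg (x : Fin n → ℂ) : 0 ≤ sqNorm x :=
  Finset.sum_nonneg fun _ _ => by positivity

theorem sqNorm_eq_zero {x : Fin n → ℂ} : sqNorm x = 0 ↔ x = 0 := by
  rw [sqNorm, Finset.sum_eq_zero_iff_of_nonneg fun _ _ => by positivity]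
  simp [funext_iff]

theorem sqNorm_pos {x : Fin n → ℂ} (hx : x ≠ 0) : 0 < sqNorm x :=
  (sqNorm_nonneg x).lt_of_ne fun h => hx (sqNorm_eq_zero.1 h.symm)

theorem sqNorm_smul (r : ℝ) (x : Fin n → ℂ) : sqNorm (r • x) = r ^ 2 * sqNorm x := by
  simp [sqNorm, mul_pow, Finset.mul_sum]

theorem coe_sqNorm (x : Fin n → ℂ) : (sqNorm x : ℂ) = star x ⬝ᵥ x := by
  simp only [sqNorm, dotProduct, Pi.star_apply, Complex.ofReal_sum]
  refine Finset.sum_congr rfl fun i _ => ?_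
  rw [RCLike.star_def, Complex.conj_mul']
  push_cast; rfl

theorem sqNorm_mulVec (U : Matrix.unitaryGroup (Fin n) ℂ) (x : Fin n → ℂ) :
    sqNorm (U.1 *ᵥ x) = sqNorm x := by
  rw [← Complex.ofReal_inj, coe_sqNorm, coe_sqNorm, Matrix.star_mulVec, ← Matrix.dotProduct_mulVec,
    Matrix.mulVec_mulVec, ← Matrix.star_eq_conjTranspose, Matrix.mem_unitaryGroup_iff'.1 U.2,
    Matrix.one_mulVec]

@[fun_prop]
theorem continuous_sqNorm : Continuous (sqNorm : (Fin n → ℂ) → ℝ) := by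
  unfold sqNorm
  fun_prop

@[fun_prop]
theorem measurable_sqNorm : Measurable (sqNorm : (Fin n → ℂ) → ℝ) := continuous_sqNorm.measurable

/-- The open Euclidean unit ball. -/
def sqBall (n : ℕ) : Set (Fin n → ℂ) := {x | sqNorm x < 1}

theorem isOpen_sqBall : IsOpen (sqBall n) := isOpen_lt continuous_sqNorm continuous_const

theorem volume_sqBall_pos : 0 < volume (sqBall n) := by
  refine isOpen_sqBall.measure_pos _ ⟨0, ?_⟩
  change sqNorm 0 < 1
  simp [sqNorm]

theorem volume_sqBall_lt_top : volume (sqBall n) < ⊤ := by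
  refine (measure_mono (t := Metric.closedBall 0 1) fun x hx => ?_).trans_lt
    measure_closedBall_lt_top
  rw [mem_closedBall_zero_iff, pi_norm_le_iff_of_nonneg zero_le_one]
  intro i
  have h1 : ‖x i‖ ^ 2 ≤ sqNorm x :=
    Finset.single_le_sum (f := fun i => ‖x i‖ ^ 2) (fun _ _ => by positivity) (Finset.mem_univ i)
  have h2 : sqNorm x < 1 := hx
  nlinarith [norm_nonneg (x i)]

/-- The image of Lebesgue measure is a multiple of it by uniqueness of Haar measure; the factor is
`1` because `U` preserves the Euclidean ball, of finite positive volume. -/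
theorem measurePreserving_mulVec (U : Matrix.unitaryGroup (Fin n) ℂ) :
    MeasurePreserving (fun x : Fin n → ℂ => U.1 *ᵥ x) volume volume := by
  let e : (Fin n → ℂ) ≃L[ℝ] (Fin n → ℂ) :=
    { toFun := fun x => U.1 *ᵥ x
      invFun := fun x => (U⁻¹).1 *ᵥ x
      left_inv := fun x => by
        change (U⁻¹).1 *ᵥ (U.1 *ᵥ x) = x
        rw [Matrix.mulVec_mulVec]
        change (U⁻¹ * U).1 *ᵥ x = x
        rw [inv_mul_cancel]
        exact Matrix.one_mulVec x
      right_inv := fun x => by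
        change U.1 *ᵥ ((U⁻¹).1 *ᵥ x) = x
        rw [Matrix.mulVec_mulVec]
        change (U * U⁻¹).1 *ᵥ x = x
        rw [mul_inv_cancel]
        exact Matrix.one_mulVec x
      map_add' := fun x y => Matrix.mulVec_add _ _ _
      map_smul' := fun c x => Matrix.mulVec_smul _ _ _
      continuous_toFun := by fun_prop
      continuous_invFun := by fun_prop }
  have hmeas : Measurable fun x : Fin n → ℂ => U.1 *ᵥ x := e.continuous.measurable
  have : (Measure.map e (volume : Measure (Fin n → ℂ))).IsAddHaarMeasure :=
    e.isAddHaarMeasure_map _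
  have h1 := Measure.isAddLeftInvariant_eq_smul (Measure.map e (volume : Measure (Fin n → ℂ))) volume
  have h2 := congrArg (fun μ : Measure (Fin n → ℂ) => μ (sqBall n)) h1
  have h3 : e ⁻¹' (sqBall n) = sqBall n := by
    ext x
    change sqNorm (U.1 *ᵥ x) < 1 ↔ sqNorm x < 1
    rw [sqNorm_mulVec]
  rw [Measure.map_apply e.continuous.measurable isOpen_sqBall.measurableSet, h3] at h2
  refine ⟨hmeas, ?_⟩
  change Measure.map e volume = volume
  set c := Measure.addHaarScalarFactor (Measure.map e (volume : Measure (Fin n → ℂ))) volume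
  have hc : (c : ENNReal) = 1 := by
    have h4 : 1 * volume (sqBall n) = (c : ENNReal) * volume (sqBall n) := by
      rw [one_mul]; exact h2
    exact ((ENNReal.mul_left_inj volume_sqBall_pos.ne' volume_sqBall_lt_top.ne).1 h4).symm
  rw [h1, show c = 1 by exact_mod_cast hc, one_smul]

end sqNorm

theorem lintegral_eq_mul_lintegral_comp_smul {E : Type*} [NormedAddCommGroup E] [NormedSpace ℝ E]
    [MeasurableSpace E] [BorelSpace E] [FiniteDimensional ℝ E] (μ : Measure E)
    [μ.IsAddHaarMeasure] {r : ℝ} (hr : 0 < r) {f : E → ENNReal} (hf : Measurable f) :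
    ∫⁻ x, f x ∂μ = ENNReal.ofReal (r ^ Module.finrank ℝ E) * ∫⁻ x, f (r • x) ∂μ := by
  have h := lintegral_map (μ := μ) hf (measurable_const_smul r)
  rw [Measure.map_addHaar_smul μ hr.ne', lintegral_smul_measure, abs_of_pos (by positivity)] at h
  rw [← h, smul_eq_mul, ← mul_assoc, ← ENNReal.ofReal_mul (by positivity),
    mul_inv_cancel₀ (by positivity), ENNReal.ofReal_one, one_mul]

section FirstEntry

variable {m : ℕ} [MeasurableSpace (Matrix.unitaryGroup (Fin (m + 1)) ℂ)]
  [BorelSpace (Matrix.unitaryGroup (Fin (m + 1)) ℂ)]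
  (haar : Measure (Matrix.unitaryGroup (Fin (m + 1)) ℂ)) [haar.IsHaarMeasure]
  [IsProbabilityMeasure haar]

theorem measurable_conj_entry : Measurable fun U : Matrix.unitaryGroup (Fin (m + 1)) ℂ =>
    starRingEnd ℂ (U.1 0 0) :=
  (Complex.continuous_conj.comp (continuous_subtype_val.matrix_elem 0 0)).measurable

/-- Average the right side over `x ↦ U⁻¹ x` and exchange the integrals. For fixed `x = |x| W e ≠ 0`,
the normalised first coordinate of `U⁻¹ x` is `(U⁻¹ W)_00 = conj (W⁻¹ U)_00`, and left invariance
removes `W`. -/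
theorem lintegral_conj_entry_mul_volume {g : ℂ → ENNReal} (hg : Measurable g) :
    (∫⁻ U, g (starRingEnd ℂ (U.1 0 0)) ∂haar) * volume (sqBall (m + 1)) =
      ∫⁻ x in sqBall (m + 1), g (x 0 / (√(sqNorm x) : ℝ)) := by
  let h : (Fin (m + 1) → ℂ) → ENNReal :=
    (sqBall (m + 1)).indicator fun x => g (x 0 / (√(sqNorm x) : ℝ))
  have hh : Measurable h := Measurable.indicator (by fun_prop) isOpen_sqBall.measurableSet
  have hinv : ∀ U : Matrix.unitaryGroup (Fin (m + 1)) ℂ, ∫⁻ x, h ((U⁻¹).1 *ᵥ x) = ∫⁻ x, h x :=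
    fun U => (measurePreserving_mulVec U⁻¹).lintegral_comp hh
  have hswap : ∫⁻ x, h x = ∫⁻ x, ∫⁻ U, h ((U⁻¹).1 *ᵥ x) ∂haar := by
    rw [← lintegral_lintegral_swap]
    · simp_rw [hinv]
      simp
    · refine (hh.comp (Continuous.measurable ?_)).aemeasurable
      exact ((continuous_subtype_val.comp continuous_inv).comp continuous_fst).matrix_mulVec
        continuous_snd
  rw [← lintegral_indicator isOpen_sqBall.measurableSet]
  change _ = ∫⁻ x, h x
  rw [hswap, ← lintegral_indicator_const isOpen_sqBall.measurableSet]
  have hne : ∀ᵐ x : Fin (m + 1) → ℂ, x ≠ 0 := Measure.ae_ne _ _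
  refine lintegral_congr_ae ?_
  filter_upwards [hne] with x hx
  have hmem : ∀ U : Matrix.unitaryGroup (Fin (m + 1)) ℂ,
      (U⁻¹).1 *ᵥ x ∈ sqBall (m + 1) ↔ x ∈ sqBall (m + 1) := by
    intro U
    change sqNorm _ < 1 ↔ sqNorm _ < 1
    rw [sqNorm_mulVec]
  by_cases hB : x ∈ sqBall (m + 1)
  · rw [Set.indicator_of_mem hB]
    have hpos := Real.sqrt_pos.2 (sqNorm_pos hx)
    have hne' : (√(sqNorm x) : ℂ) ≠ 0 := by exact_mod_cast hpos.ne'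
    obtain ⟨W, hW⟩ := exists_unitary_mulVec_single (w := (√(sqNorm x) : ℂ)⁻¹ • x) (by
      rw [star_smul, smul_dotProduct, dotProduct_smul, ← coe_sqNorm]
      conv_lhs => rw [← Real.mul_self_sqrt (sqNorm_nonneg x)]
      simp
      field_simp)
    have hWx : x = (√(sqNorm x) : ℂ) • W.1 *ᵥ Pi.single 0 1 := by
      rw [hW, smul_smul, mul_inv_cancel₀ hne', one_smul]
    have key : ∀ U : Matrix.unitaryGroup (Fin (m + 1)) ℂ,
        h ((U⁻¹).1 *ᵥ x) = g (starRingEnd ℂ ((W⁻¹ * U).1 0 0)) := by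
      intro U
      have h1 : (U⁻¹).1 *ᵥ x = (√(sqNorm x) : ℂ) • ((U⁻¹ * W).1 *ᵥ Pi.single 0 1) := by
        conv_lhs => rw [hWx]
        rw [Matrix.mulVec_smul, Matrix.mulVec_mulVec]
        rfl
      have h2 : (U⁻¹ * W).1 0 0 = starRingEnd ℂ ((W⁻¹ * U).1 0 0) := by
        rw [show U⁻¹ * W = (W⁻¹ * U)⁻¹ by group]
        rfl
      simp only [h]
      rw [Set.indicator_of_mem ((hmem U).2 hB), sqNorm_mulVec, h1, ← h2]
      congr 1
      simp
      field_simp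
    simp_rw [key]
    exact (lintegral_mul_left_eq_self (fun U : Matrix.unitaryGroup (Fin (m + 1)) ℂ =>
      g (starRingEnd ℂ (U.1 0 0))) W⁻¹).symm
  · rw [Set.indicator_of_notMem hB]
    have : ∀ U : Matrix.unitaryGroup (Fin (m + 1)) ℂ, h ((U⁻¹).1 *ᵥ x) = 0 := fun U =>
      Set.indicator_of_notMem (fun hU => hB ((hmem U).1 hU)) _
    simp_rw [this, lintegral_zero]

end FirstEntry

/-- Write `x = (a, b)` and `a = |b| t`. Then `x_0 / |x| = t / √(1 + |t|²)` no longer involves `b`,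
and the ball becomes `(1 + |t|²) |b|² < 1`. Rescaling `b` for fixed `t` separates the variables, and
`t ↦ t / √(1 + |t|²)` maps the plane onto the disk. -/
theorem lintegral_sqBall_eq_mul (p : ℕ) {g : ℂ → ENNReal} (hg : Measurable g) :
    ∫⁻ x in sqBall (p + 2), g (x 0 / (√(sqNorm x) : ℝ)) =
      (∫⁻ z in Metric.ball (0 : ℂ) 1, ENNReal.ofReal ((1 - ‖z‖ ^ 2) ^ p) * g z) *
        ∫⁻ b in sqBall (p + 1), ENNReal.ofReal (sqNorm b) := by
  let φ : ℝ → ENNReal := (Set.Iio 1).indicator 1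
  have hφ : Measurable φ := measurable_one.indicator measurableSet_Iio
  let H : ℂ × (Fin (p + 1) → ℂ) → ENNReal := fun q =>
    φ (‖q.1‖ ^ 2 + sqNorm q.2) * g (q.1 / (√(‖q.1‖ ^ 2 + sqNorm q.2) : ℝ))
  have hs2 : Measurable fun q : ℂ × (Fin (p + 1) → ℂ) => ‖q.1‖ ^ 2 + sqNorm q.2 := by
    have := (measurable_sqNorm (n := p + 1)).comp 
      (measurable_snd : Measurable (Prod.snd : ℂ × (Fin (p + 1) → ℂ) → _))
    exact (by fun_prop : Measurable fun q : ℂ × (Fin (p + 1) → ℂ) => ‖q.1‖ ^ 2).add this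
  have hH : Measurable H := by
    refine (hφ.comp hs2).mul (hg.comp (measurable_fst.div ?_))
    exact Complex.measurable_ofReal.comp (Real.continuous_sqrt.measurable.comp hs2)
  have hsucc : ∀ x : Fin (p + 2) → ℂ, sqNorm x = ‖x 0‖ ^ 2 + sqNorm fun j => x (Fin.succ j) :=
    fun x => by rw [sqNorm, Fin.sum_univ_succ, sqNorm]
  have h1 : ∫⁻ x in sqBall (p + 2), g (x 0 / (√(sqNorm x) : ℝ)) = ∫⁻ q, H q := by
    rw [← lintegral_indicator isOpen_sqBall.measurableSet,
      ← (volume_preserving_piFinSuccAbove (fun _ : Fin (p + 2) => ℂ) 0).lintegral_comp hH]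
    refine lintegral_congr fun x => ?_
    change _ = φ (‖x 0‖ ^ 2 + sqNorm fun j => x (Fin.succ j)) *
      g (x 0 / (√(‖x 0‖ ^ 2 + sqNorm fun j => x (Fin.succ j)) : ℝ))
    rw [← hsucc]
    by_cases hx : sqNorm x < 1
    · rw [Set.indicator_of_mem (show x ∈ sqBall (p + 2) from hx)]
      simp [φ, hx]
    · rw [Set.indicator_of_notMem (show x ∉ sqBall (p + 2) from hx)]
      simp [φ, hx]
  have hne : ∀ᵐ b : Fin (p + 1) → ℂ, b ≠ 0 := Measure.ae_ne _ _
  have h2 : ∫⁻ q, H q = ∫⁻ b : Fin (p + 1) → ℂ, ∫⁻ t : ℂ, ENNReal.ofReal (sqNorm b) *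
      (φ ((1 + ‖t‖ ^ 2) * sqNorm b) * g (t / (√(1 + ‖t‖ ^ 2) : ℝ))) := by
    rw [Measure.volume_eq_prod, lintegral_prod_symm _ hH.aemeasurable]
    refine lintegral_congr_ae ?_
    filter_upwards [hne] with b hb
    have hb0 := sqNorm_pos hb
    have hs := Real.sqrt_pos.2 hb0
    have hHb : Measurable fun a : ℂ => H (a, b) := hH.comp (by fun_prop)
    -- The Jacobian of `a = |b| t` on `ℂ` is `|b|²`.
    rw [lintegral_eq_mul_lintegral_comp_smul volume hs hHb, Complex.finrank_real_complex,
      Real.sq_sqrt hb0.le, ← lintegral_const_mul _ (by fun_prop)]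
    refine lintegral_congr fun t => ?_
    have e1 : ‖√(sqNorm b) • t‖ ^ 2 + sqNorm b = (1 + ‖t‖ ^ 2) * sqNorm b := by
      rw [norm_smul, mul_pow, Real.norm_of_nonneg hs.le, Real.sq_sqrt hb0.le]
      ring
    simp only [H, e1]
    congr 3
    rw [Real.sqrt_mul (by positivity), Complex.real_smul]
    have h3 : (√(sqNorm b) : ℂ) ≠ 0 := by exact_mod_cast hs.ne'
    push_cast
    field_simp
  have hm2 : Measurable fun q : (Fin (p + 1) → ℂ) × ℂ => ENNReal.ofReal (sqNorm q.1) *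
      (φ ((1 + ‖q.2‖ ^ 2) * sqNorm q.1) * g (q.2 / (√(1 + ‖q.2‖ ^ 2) : ℝ))) := by
    have hs1 : Measurable fun q : (Fin (p + 1) → ℂ) × ℂ => sqNorm q.1 :=
      measurable_sqNorm.comp measurable_fst
    have h4 : Measurable fun q : (Fin (p + 1) → ℂ) × ℂ => (1 + ‖q.2‖ ^ 2) * sqNorm q.1 := by
      fun_prop
    exact hs1.ennreal_ofReal.mul ((hφ.comp h4).mul (by fun_prop))
  rw [h1, h2, lintegral_lintegral_swap hm2.aemeasurable, ← lintegral_comp_div_sqrt p hg,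
    ← lintegral_mul_const _ (by fun_prop)]
  refine lintegral_congr fun t => ?_
  have hc : 0 < 1 + ‖t‖ ^ 2 := by positivity
  have hr : 0 < (√(1 + ‖t‖ ^ 2))⁻¹ := inv_pos.2 (Real.sqrt_pos.2 hc)
  have hr2 : (√(1 + ‖t‖ ^ 2))⁻¹ ^ 2 = (1 + ‖t‖ ^ 2)⁻¹ := by
    rw [inv_pow, Real.sq_sqrt hc.le]
  have hmb : Measurable fun b : Fin (p + 1) → ℂ =>
      ENNReal.ofReal (sqNorm b) * φ ((1 + ‖t‖ ^ 2) * sqNorm b) := by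
    have h4 : Measurable fun b : Fin (p + 1) → ℂ => (1 + ‖t‖ ^ 2) * sqNorm b := by fun_prop
    exact measurable_sqNorm.ennreal_ofReal.mul (hφ.comp h4)
  -- Rescaling `b` by `(1 + |t|²)^(-1/2)` yields the power `-(p + 1)` from the Jacobian and one more
  -- from the weight `|b|²`, in total `-(p + 2)`.
  have hfin : Module.finrank ℝ (Fin (p + 1) → ℂ) = 2 * (p + 1) := by
    rw [Module.finrank_pi_fintype]
    simp [mul_comm]
  simp_rw [← mul_assoc]
  rw [lintegral_mul_const _ hmb, lintegral_eq_mul_lintegral_comp_smul volume hr hmb, hfin, pow_mul,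
    hr2, mul_right_comm _ (g _)]
  congr 1
  rw [← lintegral_indicator isOpen_sqBall.measurableSet]
  have e2 : ∀ b : Fin (p + 1) → ℂ, ENNReal.ofReal (sqNorm ((√(1 + ‖t‖ ^ 2))⁻¹ • b)) *
      φ ((1 + ‖t‖ ^ 2) * sqNorm ((√(1 + ‖t‖ ^ 2))⁻¹ • b)) =
      ENNReal.ofReal ((1 + ‖t‖ ^ 2)⁻¹) *
        (sqBall (p + 1)).indicator (fun b => ENNReal.ofReal (sqNorm b)) b := by
    intro b
    rw [sqNorm_smul, hr2, mul_inv_cancel_left₀ hc.ne', ENNReal.ofReal_mul (by positivity), mul_assoc]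
    congr 1
    by_cases hx : sqNorm b < 1
    · rw [Set.indicator_of_mem (show b ∈ sqBall (p + 1) from hx)]
      simp [φ, hx]
    · rw [Set.indicator_of_notMem (show b ∉ sqBall (p + 1) from hx)]
      simp [φ, hx]
  simp_rw [e2]
  rw [lintegral_const_mul _ (measurable_sqNorm.ennreal_ofReal.indicator
    isOpen_sqBall.measurableSet), ← mul_assoc, ← ENNReal.ofReal_mul (by positivity)]
  congr 2
  rw [← pow_succ, inv_pow]

theorem thetaMeasure_odd (p : ℕ) :
    thetaMeasure (2 * p + 3) = (volume.restrict (Metric.ball (0 : ℂ) 1)).withDensity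
      fun z => ENNReal.ofReal ((p + 1) / Real.pi * (1 - ‖z‖ ^ 2) ^ p) := by
  have hne : (2 * (p : ℝ) + 3) ≠ 1 := by
    have : (0 : ℝ) ≤ p := Nat.cast_nonneg p
    linarith
  rw [thetaMeasure, if_neg hne]
  congr 1
  funext z
  have h1 : (2 * (p : ℝ) + 3 - 3) / 2 = p := by ring
  have h2 : (2 * (p : ℝ) + 3 - 1) / (2 * Real.pi) = (p + 1) / Real.pi := by
    field_simp; ring
  rw [h1, h2, Real.rpow_natCast]

theorem lintegral_thetaMeasure_odd (p : ℕ) {g : ℂ → ENNReal} (hg : Measurable g) :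
    ∫⁻ z, g z ∂(thetaMeasure (2 * p + 3)) = ENNReal.ofReal ((p + 1) / Real.pi) *
      ∫⁻ z in Metric.ball (0 : ℂ) 1, ENNReal.ofReal ((1 - ‖z‖ ^ 2) ^ p) * g z := by
  rw [thetaMeasure_odd, lintegral_withDensity_eq_lintegral_mul _ (by fun_prop) hg,
    ← lintegral_const_mul _ (by fun_prop)]
  refine lintegral_congr fun z => ?_
  rw [Pi.mul_apply, ENNReal.ofReal_mul (by positivity), mul_assoc]

theorem isProbabilityMeasure_thetaMeasure_odd (p : ℕ) :
    IsProbabilityMeasure (thetaMeasure (2 * p + 3)) := by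
  constructor
  have := lintegral_thetaMeasure_odd p (g := fun _ => 1) measurable_const
  simp only [lintegral_one, mul_one] at this
  rw [this, lintegral_ball_pow, ← ENNReal.ofReal_mul (by positivity)]
  have : ((p : ℝ) + 1) / Real.pi * (Real.pi / (p + 1)) = 1 := by field_simp
  rw [this, ENNReal.ofReal_one]

theorem map_conj_entry_eq_thetaMeasure {p : ℕ}
    [MeasurableSpace (Matrix.unitaryGroup (Fin (p + 2)) ℂ)]
    [BorelSpace (Matrix.unitaryGroup (Fin (p + 2)) ℂ)]
    (haar : Measure (Matrix.unitaryGroup (Fin (p + 2)) ℂ)) [haar.IsHaarMeasure]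
    [IsProbabilityMeasure haar] :
    haar.map (fun U => starRingEnd ℂ (U.1 0 0)) = thetaMeasure (2 * p + 3) := by
  have key : ∀ g : ℂ → ENNReal, Measurable g →
      ∫⁻ U, g (starRingEnd ℂ (U.1 0 0)) ∂haar = ∫⁻ z, g z ∂(thetaMeasure (2 * p + 3)) := by
    intro g hg
    -- Constant `g` expresses the volume of the ball through the same integral of `|b|²`, which
    -- therefore cancels without being computed.
    have h1 := lintegral_conj_entry_mul_volume (m := p + 1) haar (g := fun _ => 1) measurable_const
    rw [lintegral_sqBall_eq_mul p measurable_const] at h1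
    simp only [lintegral_one, measure_univ, mul_one, one_mul] at h1
    have h2 := lintegral_conj_entry_mul_volume haar hg
    rw [lintegral_sqBall_eq_mul p hg] at h2
    have hV0 := (volume_sqBall_pos (n := p + 2)).ne'
    have hVt := (volume_sqBall_lt_top (n := p + 2)).ne
    rw [← ENNReal.mul_left_inj hV0 hVt]
    refine h2.trans ?_
    rw [lintegral_thetaMeasure_odd p hg]
    conv_rhs => rw [h1, lintegral_ball_pow]
    have h3 : ENNReal.ofReal (((p : ℝ) + 1) / Real.pi) * ENNReal.ofReal (Real.pi / (p + 1)) = 1 := by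
      rw [← ENNReal.ofReal_mul (by positivity)]
      have : ((p : ℝ) + 1) / Real.pi * (Real.pi / (p + 1)) = 1 := by field_simp
      rw [this, ENNReal.ofReal_one]
    generalize ENNReal.ofReal (((p : ℝ) + 1) / Real.pi) = x at *
    generalize ENNReal.ofReal (Real.pi / ((p : ℝ) + 1)) = y at *
    rw [mul_mul_mul_comm, mul_comm x, mul_assoc, ← mul_assoc y x, mul_comm y x, h3, one_mul]
  refine Measure.ext fun s hs => ?_
  have := key (s.indicator 1) (measurable_one.indicator hs)
  rw [lintegral_indicator_one hs] at this
  rw [← this, Measure.map_apply measurable_conj_entry hs,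
    ← lintegral_indicator_one (measurable_conj_entry hs)]
  rfl

/-! ### The uniform law on the circle -/

/-- Rotation by `z` becomes a translation of `AddCircle (2 * Real.pi)`, whose volume is translation
invariant. -/
theorem lintegral_Ico_eq_addCircle {g : ℂ → ENNReal} (z : Circle) :
    ∫⁻ θ in Set.Ico 0 (2 * Real.pi), g (z * Complex.exp (θ * Complex.I)) =
      ∫⁻ θ in Set.Ico 0 (2 * Real.pi), g (Complex.exp (θ * Complex.I)) := by
  have : Fact (0 < 2 * Real.pi) := ⟨Real.two_pi_pos⟩
  have key : ∀ z : Circle, ∫⁻ θ in Set.Ico 0 (2 * Real.pi), g (z * Complex.exp (θ * Complex.I)) =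
      ∫⁻ t : AddCircle (2 * Real.pi), g (z * (AddCircle.toCircle t : ℂ)) := by
    intro z
    rw [restrict_Ico_eq_restrict_Ioc, ← AddCircle.lintegral_preimage (2 * Real.pi) 0, zero_add]
    refine lintegral_congr fun θ => ?_
    rw [AddCircle.toCircle_apply_mk]
    simp
  obtain ⟨t, rfl⟩ : ∃ t : AddCircle (2 * Real.pi), AddCircle.toCircle t = z := by
    refine ⟨((Complex.arg z : ℝ) : AddCircle (2 * Real.pi)), ?_⟩
    rw [AddCircle.toCircle_apply_mk]
    simp
  have h1 := key 1
  simp only [Circle.coe_one, one_mul] at h1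
  rw [key, h1]
  simp_rw [← Circle.coe_mul, ← AddCircle.toCircle_add]
  exact lintegral_add_left_eq_self
    (fun s : AddCircle (2 * Real.pi) => g (AddCircle.toCircle s : ℂ)) t

theorem lintegral_thetaMeasure_one {g : ℂ → ENNReal} (hg : Measurable g) :
    ∫⁻ z, g z ∂(thetaMeasure 1) = ENNReal.ofReal (1 / (2 * Real.pi)) *
      ∫⁻ θ in Set.Ico 0 (2 * Real.pi), g (Complex.exp (θ * Complex.I)) := by
  rw [thetaMeasure, if_pos rfl, lintegral_map hg (by fun_prop),
    lintegral_withDensity_eq_lintegral_mul _ measurable_const (by fun_prop),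
    ← lintegral_const_mul _ (by fun_prop)]
  rfl

theorem isProbabilityMeasure_thetaMeasure_one : IsProbabilityMeasure (thetaMeasure 1) := by
  constructor
  have := lintegral_thetaMeasure_one (g := fun _ => 1) measurable_const
  simp only [lintegral_one, Measure.restrict_apply_univ, Real.volume_Ico, sub_zero] at this
  rw [this, ← ENNReal.ofReal_mul (by positivity)]
  have : 1 / (2 * Real.pi) * (2 * Real.pi) = 1 := by field_simp
  rw [this, ENNReal.ofReal_one]

/-- Invariance under scalar phases allows averaging over the phase; after exchanging the integrals,
the phase integral does not depend on `U`, whose only entry has modulus one. -/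
theorem map_conj_entry_fin_one [MeasurableSpace (Matrix.unitaryGroup (Fin 1) ℂ)]
    [BorelSpace (Matrix.unitaryGroup (Fin 1) ℂ)]
    (haar : Measure (Matrix.unitaryGroup (Fin 1) ℂ)) [haar.IsHaarMeasure]
    [IsProbabilityMeasure haar] :
    haar.map (fun U => starRingEnd ℂ (U.1 0 0)) = thetaMeasure 1 := by
  have hU : ∀ U : Matrix.unitaryGroup (Fin 1) ℂ, ‖U.1 0 0‖ = 1 := by
    intro U
    have := congrFun (congrFun (Matrix.mem_unitaryGroup_iff.1 U.2) 0) 0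
    have h1 : U.1 0 0 * starRingEnd ℂ (U.1 0 0) = 1 := by
      simpa [Matrix.mul_apply, Matrix.star_apply] using this
    rw [Complex.mul_conj'] at h1
    have h2 : ‖U.1 0 0‖ ^ 2 = 1 := by
      rw [← Complex.ofReal_inj, Complex.ofReal_pow, h1, Complex.ofReal_one]
    exact (pow_eq_one_iff_of_nonneg (norm_nonneg _) two_ne_zero).1 h2
  have key : ∀ g : ℂ → ENNReal, Measurable g →
      ∫⁻ U, g (starRingEnd ℂ (U.1 0 0)) ∂haar = ∫⁻ z, g z ∂(thetaMeasure 1) := by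
    intro g hg
    rw [lintegral_thetaMeasure_one hg]
    have h1 : ∀ θ : ℝ, ∫⁻ U, g (starRingEnd ℂ (U.1 0 0)) ∂haar =
        ∫⁻ U, g (starRingEnd ℂ (U.1 0 0) * Complex.exp (θ * Complex.I)) ∂haar := by
      intro θ
      -- The phase is `-θ` because the entry is conjugated afterwards.
      let D : Matrix.unitaryGroup (Fin 1) ℂ := ⟨Matrix.of fun _ _ => Complex.exp (-θ * Complex.I), by
        rw [Matrix.mem_unitaryGroup_iff]
        ext i j
        have : i = j := Subsingleton.elim _ _
        subst this
        simp [Matrix.mul_apply, Matrix.star_apply, ← Complex.exp_conj, ← Complex.exp_add]⟩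
      rw [← lintegral_mul_left_eq_self (fun U : Matrix.unitaryGroup (Fin 1) ℂ =>
        g (starRingEnd ℂ (U.1 0 0))) D]
      refine lintegral_congr fun U => ?_
      congr 1
      change starRingEnd ℂ ((D.1 * U.1) 0 0) = _
      simp [Matrix.mul_apply, D, ← Complex.exp_conj, mul_comm]
    have h2 : ∫⁻ θ in Set.Ico 0 (2 * Real.pi), ∫⁻ U, g (starRingEnd ℂ (U.1 0 0) *
        Complex.exp ((θ : ℝ) * Complex.I)) ∂haar =
        ∫⁻ θ in Set.Ico 0 (2 * Real.pi), g (Complex.exp ((θ : ℝ) * Complex.I)) := by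
      rw [lintegral_lintegral_swap]
      · have h3 : ∀ U : Matrix.unitaryGroup (Fin 1) ℂ, ∫⁻ θ in Set.Ico 0 (2 * Real.pi),
            g (starRingEnd ℂ (U.1 0 0) * Complex.exp ((θ : ℝ) * Complex.I)) =
            ∫⁻ θ in Set.Ico 0 (2 * Real.pi), g (Complex.exp ((θ : ℝ) * Complex.I)) := fun U =>
          lintegral_Ico_eq_addCircle (g := g) ⟨starRingEnd ℂ (U.1 0 0),
            mem_sphere_zero_iff_norm.2 (by rw [RCLike.norm_conj, hU])⟩
        simp_rw [h3]
        simp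
      · refine (hg.comp ?_).aemeasurable
        exact (measurable_conj_entry.comp measurable_snd).mul (by fun_prop)
    rw [← h2]
    simp_rw [← h1]
    rw [lintegral_const, Measure.restrict_apply_univ, Real.volume_Ico, sub_zero, mul_comm, mul_assoc,
      ← ENNReal.ofReal_mul (by positivity)]
    have : 2 * Real.pi * (1 / (2 * Real.pi)) = 1 := by field_simp
    rw [this, ENNReal.ofReal_one, mul_one]
  refine Measure.ext fun s hs => ?_
  have := key (s.indicator 1) (measurable_one.indicator hs)
  rw [lintegral_indicator_one hs] at this
  rw [← this, Measure.map_apply measurable_conj_entry hs,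
    ← lintegral_indicator_one (measurable_conj_entry hs)]
  rfl

/-! ### The joint law of the recurrence coefficients -/

/-- The laws `Θ_{2n-2k-1}`, `k < n`, where `n = m + 1`. -/
noncomputable def thetaFamily (m : ℕ) (k : Fin (m + 1)) : Measure ℂ :=
  thetaMeasure (2 * ((m + 1 : ℕ) : ℝ) - 2 * ((k : ℕ) : ℝ) - 1)

theorem thetaFamily_castSucc (m : ℕ) (k : Fin m) :
    thetaFamily m k.castSucc = thetaMeasure (2 * ((m - 1 - k : ℕ) : ℝ) + 3) := by
  have h : (((m - 1 - k : ℕ) : ℝ)) + 1 + k = m := by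
    have : m - 1 - (k : ℕ) + 1 + k = m := by omega
    exact_mod_cast this
  rw [thetaFamily]
  congr 1
  push_cast
  rw [← h]
  simp
  ring

theorem thetaFamily_last (m : ℕ) : thetaFamily m (Fin.last m) = thetaMeasure 1 := by
  rw [thetaFamily]
  congr 1
  push_cast
  ring

theorem thetaFamily_succ_zero (m : ℕ) : thetaFamily (m + 1) 0 = thetaMeasure (2 * m + 3) := by
  rw [thetaFamily]
  congr 1
  push_cast
  simp
  ring

/-- The parameter `2n - 2k - 1` depends only on `n - k`, which is what lets the induction close. -/
theorem thetaFamily_succ_succ (m : ℕ) (k : Fin (m + 1)) :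
    thetaFamily (m + 1) k.succ = thetaFamily m k := by
  rw [thetaFamily, thetaFamily]
  congr 1
  push_cast [Fin.val_succ]
  ring

instance isProbabilityMeasure_thetaFamily (m : ℕ) (k : Fin (m + 1)) :
    IsProbabilityMeasure (thetaFamily m k) := by
  refine Fin.lastCases ?_ (fun k => ?_) k
  · rw [thetaFamily_last]
    exact isProbabilityMeasure_thetaMeasure_one
  · rw [thetaFamily_castSucc]
    exact isProbabilityMeasure_thetaMeasure_odd _

theorem measurable_finCons (m : ℕ) : Measurable fun q : ℂ × (Fin (m + 1) → ℂ) =>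
    (Fin.cons q.1 q.2 : Fin (m + 2) → ℂ) := by
  refine measurable_pi_iff.2 fun k => ?_
  refine Fin.cases ?_ (fun k => ?_) k
  · simpa using measurable_fst
  · simp only [Fin.cons_succ]
    exact (measurable_pi_apply k).comp measurable_snd

theorem lintegral_pi_thetaFamily_succ (m : ℕ) {F : (Fin (m + 2) → ℂ) → ENNReal}
    (hF : Measurable F) :
    ∫⁻ x, F x ∂(Measure.pi (thetaFamily (m + 1))) =
      ∫⁻ a, ∫⁻ b, F (Fin.cons a b) ∂(Measure.pi (thetaFamily m)) ∂(thetaMeasure (2 * m + 3)) := by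
  have hmp := measurePreserving_piFinSuccAbove (thetaFamily (m + 1)) 0
  have h1 := hmp.lintegral_comp (hF.comp (measurable_finCons m))
  have h2 : ∀ x : Fin (m + 2) → ℂ, (F ∘ fun q : ℂ × (Fin (m + 1) → ℂ) =>
      (Fin.cons q.1 q.2 : Fin (m + 2) → ℂ))
        ((MeasurableEquiv.piFinSuccAbove (fun _ : Fin (m + 2) => ℂ) 0) x) = F x := by
    intro x
    change F (Fin.cons (x 0) fun j => x (Fin.succ j)) = F x
    exact congrArg F (Fin.cons_self_tail x)
  simp_rw [h2] at h1
  have h3 : (fun j => thetaFamily (m + 1) (Fin.succAbove 0 j)) = thetaFamily m := by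
    funext j
    rw [Fin.succAbove_zero, thetaFamily_succ_succ]
  rw [h1, h3, thetaFamily_succ_zero]
  have : SFinite (thetaMeasure (2 * m + 3)) :=
    have := isProbabilityMeasure_thetaMeasure_odd m
    inferInstance
  rw [lintegral_prod _ (hF.comp (measurable_finCons m)).aemeasurable]
  rfl

/-- By right invariance of `μ`, multiplication by an independent `1 ⊕ V` does not change the law of
`U`. -/
theorem lintegral_mul_unitarySum {m : ℕ}
    [MeasurableSpace (Matrix.unitaryGroup (Fin (m + 2)) ℂ)]
    [BorelSpace (Matrix.unitaryGroup (Fin (m + 2)) ℂ)]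
    [MeasurableSpace (Matrix.unitaryGroup (Fin (m + 1)) ℂ)]
    [BorelSpace (Matrix.unitaryGroup (Fin (m + 1)) ℂ)]
    (μ : Measure (Matrix.unitaryGroup (Fin (m + 2)) ℂ)) [μ.IsHaarMeasure] [IsProbabilityMeasure μ]
    (ν : Measure (Matrix.unitaryGroup (Fin (m + 1)) ℂ)) [IsProbabilityMeasure ν]
    {f : Matrix.unitaryGroup (Fin (m + 2)) ℂ → ENNReal} (hf : Measurable f) :
    ∫⁻ U, f U ∂μ = ∫⁻ U, ∫⁻ V, f (U * unitarySum V) ∂ν ∂μ := by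
  have := isMulRightInvariant_of_isProbabilityMeasure μ
  rw [lintegral_lintegral_swap]
  · simp_rw [lintegral_mul_right_eq_self f]
    simp
  · refine (hf.comp (Continuous.measurable ?_)).aemeasurable
    exact continuous_fst.mul (continuous_unitarySum.comp continuous_snd)

theorem ae_norm_entry_lt_one {m : ℕ} [MeasurableSpace (Matrix.unitaryGroup (Fin (m + 2)) ℂ)]
    [BorelSpace (Matrix.unitaryGroup (Fin (m + 2)) ℂ)]
    (μ : Measure (Matrix.unitaryGroup (Fin (m + 2)) ℂ)) [μ.IsHaarMeasure] [IsProbabilityMeasure μ] :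
    ∀ᵐ U ∂μ, ‖U.1 0 0‖ < 1 := by
  have h : ∀ᵐ z ∂(thetaMeasure (2 * m + 3)), z ∈ Metric.ball (0 : ℂ) 1 := by
    rw [thetaMeasure_odd]
    exact (withDensity_absolutelyContinuous _ _).ae_le (ae_restrict_mem Metric.isOpen_ball.measurableSet)
  rw [← map_conj_entry_eq_thetaMeasure μ] at h
  filter_upwards [ae_of_ae_map measurable_conj_entry.aemeasurable h] with U hU
  simpa using hU

theorem measurable_pi_recCoeff (m : ℕ) [MeasurableSpace (Matrix.unitaryGroup (Fin (m + 1)) ℂ)]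
    [BorelSpace (Matrix.unitaryGroup (Fin (m + 1)) ℂ)] :
    Measurable fun (U : Matrix.unitaryGroup (Fin (m + 1)) ℂ) (k : Fin (m + 1)) =>
      recCoeff (spectralAt U) k :=
  measurable_pi_iff.2 fun k => measurable_recCoeff k

/-- Randomise `U` to `U (1 ⊕ V)` and integrate over `V` first. The two claims are proved together,
since the coefficients of `U (1 ⊕ V)` are known only where the recursion for `g V h` is valid. -/
theorem law_recCoeff (m : ℕ) : ∀ [MeasurableSpace (Matrix.unitaryGroup (Fin (m + 1)) ℂ)]
    [BorelSpace (Matrix.unitaryGroup (Fin (m + 1)) ℂ)]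
    (μ : Measure (Matrix.unitaryGroup (Fin (m + 1)) ℂ)) [μ.IsHaarMeasure] [IsProbabilityMeasure μ],
    (∀ᵐ U ∂μ, IsSzego U.1 (recCoeff (spectralAt U))) ∧
      μ.map (fun U (k : Fin (m + 1)) => recCoeff (spectralAt U) k) =
        Measure.pi (thetaFamily m) := by
  induction m with
  | zero =>
    intro _ _ μ _ _
    have h : ∀ U : Matrix.unitaryGroup (Fin 1) ℂ, IsSzego U.1 fun _ => starRingEnd ℂ (U.1 0 0) :=
      fun U => isSzego_fin_one (by simp)
    refine ⟨Filter.Eventually.of_forall fun U => (h U).congr (h U).eq_recCoeff, ?_⟩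
    refine (Measure.pi_eq fun s hs => ?_).symm
    rw [Measure.map_apply (measurable_pi_recCoeff 0)
      (MeasurableSet.univ_pi hs), Fin.prod_univ_one, show (0 : Fin 1) = Fin.last 0 from rfl,
      thetaFamily_last, ← map_conj_entry_fin_one μ, Measure.map_apply measurable_conj_entry (hs _)]
    congr 1
    ext U
    have h0 : recCoeff (spectralAt U) 0 = starRingEnd ℂ (U.1 0 0) := ((h U).eq_recCoeff 0 le_rfl).symm
    rw [Set.mem_preimage, Set.mem_preimage, Set.mem_univ_pi, Fin.forall_fin_one]
    change recCoeff (spectralAt U) 0 ∈ s 0 ↔ _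
    rw [h0]
    rfl
  | succ m ih =>
    intro _ _ μ _ _
    let _ : MeasurableSpace (Matrix.unitaryGroup (Fin (m + 1)) ℂ) := borel _
    have _ : BorelSpace (Matrix.unitaryGroup (Fin (m + 1)) ℂ) := ⟨rfl⟩
    obtain ⟨ν, hν1, hν2⟩ :=
      exists_isHaarMeasure_isProbabilityMeasure (Matrix.unitaryGroup (Fin (m + 1)) ℂ)
    have := isMulRightInvariant_of_isProbabilityMeasure ν
    obtain ⟨ih1, ih2⟩ := ih ν
    -- The translations `g`, `h` depend on `U`, but are used only in the inner integral at fixed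
    -- `U`, so no measurable choice of them is required.
    have hmp : ∀ g h, MeasurePreserving (fun V => g * V * h) ν ν := fun g h =>
      (measurePreserving_mul_right ν h).comp (measurePreserving_mul_left ν g)
    have hae : ∀ g h, ∀ᵐ V ∂ν,
        IsSzego (g * V * h).1 (recCoeff (spectralAt (g * V * h))) := fun g h =>
      (hmp g h).quasiMeasurePreserving.ae ih1
    have hc := measurable_pi_recCoeff
    constructor
    · have hS := (measurableSet_isSzego (m := m + 1)).compl
      rw [ae_iff]
      change μ {U : Matrix.unitaryGroup (Fin (m + 1 + 1)) ℂ |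
        IsSzego U.1 (recCoeff (spectralAt U))}ᶜ = 0
      rw [← lintegral_indicator_one hS,
        lintegral_mul_unitarySum μ ν (measurable_one.indicator hS)]
      refine (lintegral_congr_ae (g := fun _ => 0) ?_).trans lintegral_zero
      filter_upwards [ae_norm_entry_lt_one μ] with U hU
      obtain ⟨g, h, hgh⟩ := exists_right_translate U hU
      refine (lintegral_congr_ae (g := fun _ => 0) ?_).trans lintegral_zero
      filter_upwards [hae g h] with V hV
      have hmem : U * unitarySum V ∉ {U : Matrix.unitaryGroup (Fin (m + 1 + 1)) ℂ |
          IsSzego U.1 (recCoeff (spectralAt U))}ᶜ := fun hn => hn (hgh V hV).1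
      exact Set.indicator_of_notMem hmem _
    · refine Measure.ext_of_lintegral _ fun F hF => ?_
      rw [lintegral_map hF (hc (m + 1))]
      refine (lintegral_mul_unitarySum μ ν (hF.comp (hc (m + 1)))).trans ?_
      rw [lintegral_pi_thetaFamily_succ m hF, ← map_conj_entry_eq_thetaMeasure μ, ← ih2]
      have hFc := hF.comp (measurable_finCons m)
      have hprod : Measurable fun a : ℂ => ∫⁻ b, F (Fin.cons a b) ∂(ν.map
          fun U (k : Fin (m + 1)) => recCoeff (spectralAt U) k) := by
        have : IsProbabilityMeasure (ν.map fun U (k : Fin (m + 1)) => recCoeff (spectralAt U) k) :=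
          Measure.isProbabilityMeasure_map (hc m).aemeasurable
        exact hFc.lintegral_prod_right'
      rw [lintegral_map hprod measurable_conj_entry]
      refine lintegral_congr_ae ?_
      filter_upwards [ae_norm_entry_lt_one μ] with U hU
      obtain ⟨g, h, hgh⟩ := exists_right_translate U hU
      have hFU : Measurable fun b : Fin (m + 1) → ℂ =>
          F (Fin.cons (starRingEnd ℂ (U.1 0 0)) b) :=
        hFc.comp (measurable_const.prodMk measurable_id)
      rw [lintegral_map hFU (hc m)]
      refine Eq.trans ?_ ((hmp g h).lintegral_comp (hFU.comp (hc m)))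
      refine lintegral_congr_ae ?_
      filter_upwards [hae g h] with V hV
      exact congrArg F (hgh V hV).2

/-! ### Product densities -/

theorem lintegral_fin_prod_eq_prod {n : ℕ} {α : Fin n → Type*} [∀ i, MeasurableSpace (α i)]
    (μ : ∀ i, Measure (α i)) [∀ i, SigmaFinite (μ i)] {f : ∀ i, α i → ENNReal}
    (hf : ∀ i, Measurable (f i)) :
    ∫⁻ x, ∏ i, f i (x i) ∂(Measure.pi μ) = ∏ i, ∫⁻ y, f i y ∂(μ i) := by
  induction n with
  | zero => simp
  | succ n ih =>
    have hmp := measurePreserving_piFinSuccAbove μ 0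
    have hm : Measurable fun y : ∀ i : Fin n, α (Fin.succAbove 0 i) =>
        ∏ i, f (Fin.succAbove 0 i) (y i) :=
      Finset.measurable_prod _ fun i _ => (hf _).comp (measurable_pi_apply i)
    have hm2 : Measurable fun q : α 0 × (∀ i : Fin n, α (Fin.succAbove 0 i)) =>
        f 0 q.1 * ∏ i, f (Fin.succAbove 0 i) (q.2 i) :=
      ((hf 0).comp measurable_fst).mul (hm.comp measurable_snd)
    have h1 := hmp.lintegral_comp hm2
    rw [lintegral_prod_mul (hf 0).aemeasurable hm.aemeasurable, ih _ fun i => hf _] at h1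
    rw [Fin.prod_univ_succ]
    refine Eq.trans (lintegral_congr fun x => ?_) h1
    rw [Fin.prod_univ_succ]
    rfl

theorem pi_withDensity {n : ℕ} {α : Fin n → Type*} [∀ i, MeasurableSpace (α i)]
    (μ : ∀ i, Measure (α i)) [∀ i, SigmaFinite (μ i)] {f : ∀ i, α i → ENNReal}
    (hf : ∀ i, Measurable (f i)) [∀ i, SigmaFinite ((μ i).withDensity (f i))] :
    Measure.pi (fun i => (μ i).withDensity (f i)) =
      (Measure.pi μ).withDensity fun x => ∏ i, f i (x i) := by
  refine Measure.pi_eq fun s hs => ?_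
  rw [withDensity_apply _ (MeasurableSet.univ_pi hs), Measure.restrict_pi_pi,
    lintegral_fin_prod_eq_prod _ hf]
  exact Finset.prod_congr rfl fun i _ => (withDensity_apply _ (hs i)).symm

/-- The constants `(m - k) / π` of the disk laws multiply to `m! / π ^ m`, and the circle
contributes `1 / (2π)`; together they give the stated normalisation with `n = m + 1`. -/
theorem map_verblunskyDensityMeasure (m : ℕ) :
    (verblunskyDensityMeasure (m + 1)).map (fun p => (p.1, Complex.exp (p.2 * Complex.I))) =
      (Measure.pi fun k : Fin m => thetaFamily m k.castSucc).prod (thetaFamily m (Fin.last m)) := by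
  let d : Fin m → ℂ → ENNReal := fun k z =>
    ENNReal.ofReal ((((m - 1 - k : ℕ) : ℝ) + 1) / Real.pi * (1 - ‖z‖ ^ 2) ^ (m - 1 - (k : ℕ)))
  have hd : ∀ k, Measurable (d k) := fun k => by fun_prop
  have hθ : ∀ k : Fin m, thetaFamily m k.castSucc =
      (volume.restrict (Metric.ball (0 : ℂ) 1)).withDensity (d k) := fun k => by
    rw [thetaFamily_castSucc, thetaMeasure_odd]
  have hσ : ∀ k, SigmaFinite ((volume.restrict (Metric.ball (0 : ℂ) 1)).withDensity (d k)) :=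
    fun k => by rw [← hθ]; infer_instance
  have hpi : (Measure.pi fun k : Fin m => thetaFamily m k.castSucc) =
      (volume.restrict {a : Fin m → ℂ | ∀ k, ‖a k‖ < 1}).withDensity fun x => ∏ k, d k (x k) := by
    simp_rw [hθ]
    rw [pi_withDensity _ hd, ← Measure.restrict_pi_pi, ← volume_pi]
    congr 2
    ext a
    simp
  have hone : thetaFamily m (Fin.last m) = ((volume.restrict (Set.Ico 0 (2 * Real.pi))).withDensity
      (fun _ => ENNReal.ofReal (1 / (2 * Real.pi)))).map
      (fun φ : ℝ => Complex.exp (φ * Complex.I)) := by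
    rw [thetaFamily_last, thetaMeasure, if_pos rfl]
  have hdp : Measurable fun x : Fin m → ℂ => ∏ k, d k (x k) :=
    Finset.measurable_prod _ fun k _ => (hd k).comp (measurable_pi_apply k)
  have hdens : verblunskyDensityMeasure (m + 1) =
      (Measure.pi fun k : Fin m => thetaFamily m k.castSucc).prod
        ((volume.restrict (Set.Ico 0 (2 * Real.pi))).withDensity
          (fun _ => ENNReal.ofReal (1 / (2 * Real.pi)))) := by
    rw [hpi, prod_withDensity hdp measurable_const]
    -- `ENNReal.ofReal` is multiplicative only on nonnegative factors, so the densities are compared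
    -- inside the polydisk, where `1 - |α_k|² > 0`.
    refine withDensity_congr_ae ?_
    have hmem : ∀ᵐ p ∂((volume.restrict {a : Fin m → ℂ | ∀ k, ‖a k‖ < 1}).prod
        (volume.restrict (Set.Ico 0 (2 * Real.pi)))), ∀ k, ‖p.1 k‖ < 1 := by
      have hset : MeasurableSet {a : Fin m → ℂ | ∀ k, ‖a k‖ < 1} := by
        simp only [Set.ofPred_forall]
        exact MeasurableSet.iInter fun k =>
          measurableSet_lt (measurable_norm.comp (measurable_pi_apply k)) measurable_const
      exact Measure.quasiMeasurePreserving_fst.ae (ae_restrict_mem hset)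
    filter_upwards [hmem] with p hp
    have hnn : ∀ k : Fin m, 0 ≤ (((m - 1 - k : ℕ) : ℝ) + 1) / Real.pi *
        (1 - ‖p.1 k‖ ^ 2) ^ (m - 1 - (k : ℕ)) := by
      intro k
      have h1 : 0 ≤ 1 - ‖p.1 k‖ ^ 2 := by nlinarith [norm_nonneg (p.1 k), hp k]
      positivity
    simp only [d]
    rw [← ENNReal.ofReal_prod_of_nonneg fun k _ => hnn k, ← ENNReal.ofReal_mul
      (Finset.prod_nonneg fun k _ => hnn k), Finset.prod_mul_distrib]
    have hfact : ∏ k : Fin m, ((((m - 1 - k : ℕ) : ℝ) + 1) / Real.pi) =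
        (m.factorial : ℝ) / Real.pi ^ m := by
      rw [Finset.prod_div_distrib, Finset.prod_const, Finset.card_univ, Fintype.card_fin]
      congr 1
      rw [Fin.prod_univ_eq_prod_range (fun k => (((m - 1 - k : ℕ) : ℝ) + 1)) m,
        Finset.prod_range_reflect (fun k => ((k : ℝ) + 1)) m, ← Finset.prod_range_add_one_eq_factorial]
      push_cast
      rfl
    rw [hfact]
    congr 1
    change 1 / 2 * ((m.factorial : ℝ) / Real.pi ^ (m + 1)) *
      ∏ k : Fin m, (1 - ‖p.1 k‖ ^ 2) ^ (m - 1 - (k : ℕ)) = _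
    field_simp
    ring
  have hexp : Measurable fun φ : ℝ => Complex.exp (φ * Complex.I) := by fun_prop
  rw [hdens, hone]
  have hprob : IsProbabilityMeasure (((volume.restrict (Set.Ico 0 (2 * Real.pi))).withDensity
      (fun _ => ENNReal.ofReal (1 / (2 * Real.pi)))).map
      (fun φ : ℝ => Complex.exp (φ * Complex.I))) := by
    rw [← hone]; infer_instance
  have hsf : SFinite (((volume.restrict (Set.Ico 0 (2 * Real.pi))).withDensity
      (fun _ => ENNReal.ofReal (1 / (2 * Real.pi))))) := inferInstance
  exact (Measure.map_prod_map _ _ measurable_id hexp).symm.trans (by rw [Measure.map_id])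

/-! ### Transfer to the random matrix: recurrence, density, independence, marginals. -/

theorem mainTheorem5 (n : ℕ) [NeZero n]
    [MeasurableSpace (Matrix.unitaryGroup (Fin n) ℂ)] [BorelSpace (Matrix.unitaryGroup (Fin n) ℂ)]
    (haar : Measure (Matrix.unitaryGroup (Fin n) ℂ)) [haar.IsHaarMeasure]
    [IsProbabilityMeasure haar]
    {Ω : Type*} [MeasurableSpace Ω] (P : Measure Ω)
    (U : Ω → Matrix.unitaryGroup (Fin n) ℂ) (hU : HasLaw U haar P)
    (α : ℕ → Ω → ℂ)
    (hα : ∀ k ω, α k ω = verblunsky (spectralMeasure (U ω) (Pi.single 0 1)) k) :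
    (∀ᵐ ω ∂P, ∀ k < n, ∀ a : ℂ,
        IsRecurrenceCoeff (spectralMeasure (U ω) (Pi.single 0 1)) k a ↔ a = α k ω) ∧
      HasLaw (fun ω => ((fun k : Fin (n - 1) => α k ω), α (n - 1) ω))
          ((verblunskyDensityMeasure n).map (fun p => (p.1, Complex.exp (p.2 * Complex.I)))) P ∧
      iIndepFun (fun (k : Fin n) ω => α k ω) P ∧
      ∀ k : Fin n, HasLaw (α k) (thetaMeasure (2 * n - 2 * k - 1)) P := by
  obtain ⟨m, rfl⟩ : ∃ m, n = m + 1 := ⟨n - 1, by have := NeZero.pos n; omega⟩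
  obtain ⟨hgood, hlaw⟩ := law_recCoeff m haar
  have hP := hU.isProbabilityMeasure
  have hgoodP : ∀ᵐ ω ∂P, IsSzego (U ω).1 (recCoeff (spectralAt (U ω))) := by
    rw [← hU.map_eq] at hgood
    exact ae_of_ae_map hU.aemeasurable hgood
  have hrec : ∀ᵐ ω ∂P, ∀ k < m + 1, ∀ a : ℂ,
      IsRecurrenceCoeff (spectralMeasure (U ω) (Pi.single 0 1)) k a ↔ a = α k ω := by
    filter_upwards [hgoodP] with ω hω k hk a
    have h1 := hω.isRecurrenceCoeff k (by omega)
    have h2 : α k ω = recCoeff (spectralAt (U ω)) k := (hα k ω).trans (verblunsky_eq_recCoeff h1)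
    rw [h2]
    exact ⟨fun h => h.eq_recCoeff, fun h => h ▸ h1⟩
  have hX : HasLaw (fun ω (k : Fin (m + 1)) => α k ω) (Measure.pi (thetaFamily m)) P := by
    have h1 : HasLaw (fun (V : Matrix.unitaryGroup (Fin (m + 1)) ℂ) (k : Fin (m + 1)) =>
        recCoeff (spectralAt V) k) (Measure.pi (thetaFamily m)) haar :=
      ⟨(measurable_pi_recCoeff m).aemeasurable, hlaw⟩
    refine (h1.comp hU).congr ?_
    filter_upwards [hgoodP] with ω hω
    funext k
    exact (hα k ω).trans (verblunsky_eq_recCoeff (hω.isRecurrenceCoeff k (by omega)))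
  have hlawk : ∀ k : Fin (m + 1), HasLaw (α k) (thetaFamily m k) P := fun k =>
    ((measurePreserving_eval (thetaFamily m) k).hasLaw).comp hX
  refine ⟨hrec, ?_, ?_, hlawk⟩
  -- Splitting off the last index puts it in the first component, hence the swap.
  · have hmp := (measurePreserving_piFinSuccAbove (thetaFamily m) (Fin.last m))
    have h2 := (Measure.measurePreserving_swap.comp hmp).hasLaw.comp hX
    have h3 := map_verblunskyDensityMeasure m
    have h4 : (fun j => thetaFamily m ((Fin.last m).succAbove j)) =
        fun k : Fin m => thetaFamily m k.castSucc := by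
      funext j; rw [Fin.succAbove_last]
    rw [h4, ← h3] at h2
    refine h2.congr (Filter.EventuallyEq.of_eq ?_)
    funext ω
    refine Prod.ext ?_ ?_
    · funext k
      change α k ω = α (((Fin.last m).succAbove k : Fin (m + 1)) : ℕ) ω
      rw [Fin.succAbove_last]
      rfl
    · rfl
  · rw [iIndepFun_iff_map_fun_eq_pi_map fun k => (hlawk k).aemeasurable, hX.map_eq]
    congr 1
    funext k
    exact (hlawk k).map_eq.symm
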